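/- Let $n\ge 1$, $0\le\delta\le\rho<1$ and $-n(1-\rho)\le m<0$. Let $S^m_{\rho,\delta}$ be the class of all $a\in C^\infty(\mathbb R^n\times\mathbb R^n)$ with $|\partial_x^\nu\partial_\xi^\sigma a(x,\xi)|\le C_{\nu,\sigma}(1+|\xi|)^{m-\rho|\sigma|+\delta|\nu|}$ for all multi-indices $\nu,\sigma$, and let $$T_af(x)=(2\pi)^{-n}\int_{\mathbb R^n}e^{ix\cdot\xi}a(x,\xi)\widehat f(\xi)\,d\xi,\qquad \widehat f(\xi)=\int_{\mathbb R^n} e^{-iy\cdot\xi}f(y)\,dy.$$ A dyadic cube is a cube of the form $\prod_{i=1}^n 2^k\big[c_i+\tfrac{v_i}{3},\,c_i+1+\tfrac{v_i}{3}\big)$ with $k\in\mathbb Z$, $c\in\mathbb Z^n$, $v\in\{0,1,2\}^n$. A collection $\mathcal S$ of dyadic cubes is $\eta$-sparse if there are pairwise disjoint measurable sets $E_Q\subset Q$ ($Q\in\mathcal S$) with $|E_Q|>\eta|Q|$. For $1\le p,q<\infty$ put $$\Lambda_{\mathcal S,p,q}(f,g)=\sum_{Q\in\mathcal S}|Q|\,\langle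 f\rangle_{p,Q}\langle g\rangle_{q,Q},\qquad \langle f\rangle_{p,Q}^p=\frac1{|Q|}\int_Q|f|^p.$$ Say that $T_a$ satisfies a $(p,q)$ sparse bound if there are $\eta\in(0,1)$ and $C<\infty$ such that for all $f,g\in C_c^\infty(\mathbb R^n)$ there is an $\eta$-sparse collection $\mathcal S$ with $|\langle T_af,g\rangle|\le C\,\Lambda_{\mathcal S,p,q}(f,g)$. (This is implied by the same bound for all bounded compactly supported $f,g$.) Let $\mathcal T_{m,\rho,n}\subset\mathbb R^2$ be the open trapezoid (the interior of the convex hull) with vertices $$v_1=(1,0),\quad v_2=\Big(1,\tfrac{-m}{n(1-\rho)}\Big),\quad v_3=\Big(\tfrac{-m}{n(1-\rho)},1\Big),\quad v_4=(0,1)$$ if $-n(1-\rho)\le m\le -n(1-\rho)/2$, and $$v_1=\Big(\tfrac12-\tfrac{m}{n(1-\rho)},\tfrac12+\tfrac{m}{n(1-\rho)}\Big),\quad v_2=\Big(\tfrac12-\tfrac{m}{n(1-\rho)},\tfrac12\Big),$$ $$v_3=\Big(\tfrac12,\tfrac12-\tfrac{m}{n(1-\rho)}\Big),\quad v_4=\Big(\tfrac12+\tfrac{m}{n(1-\rho)},\tfrac12-\tfrac{m}{n(1-\rho)}\Big)$$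 if $-n(1-\rho)/2<m<0$. Then there is a symbol $a\in S^m_{\rho,\delta}$ such that, for all exponents $1\le r<s\le\infty$ with dual exponent $s'=s/(s-1)$ (that is, for all real $r,s'\ge1$ with $1/r+1/s'>1$): (i) if $(1/r,1/s')$ lies outside the closure of $\mathcal T_{m,\rho,n}$, then $T_a$ satisfies no $(r,s')$ sparse bound; (ii) if $-n(1-\rho)/2<m<0$ and $1/r>\tfrac12-\tfrac{m}{n(1-\rho)}$, then $T_a$ satisfies no $(r,s')$ sparse bound. -/

import Mathlib

open scoped ContDiff FourierTransform ENNReal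

noncomputable section

namespace PseudoSparse

/-- `ℝⁿ` with its Euclidean norm and Lebesgue measure. -/
abbrev E (n : ℕ) : Type := EuclideanSpace ℝ (Fin n)

/-- The Hörmander class `S^m_{ρ,δ}` on `ℝⁿ × ℝⁿ`: smooth functions `a` all of whose mixed
derivatives, of order `l` in `x` and of order `k` in `ξ`, are
`O((1 + |ξ|) ^ (m - ρ k + δ l))`, uniformly in `x` and `ξ`.  The norm of the full derivative
tensor of order `(l, k)` is comparable to the largest of the partial derivatives
`∂_x^ν ∂_ξ^σ a` with `|ν| = l` and `|σ| = k`. -/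
def IsSymbol {n : ℕ} (m ρ δ : ℝ) (a : E n → E n → ℂ) : Prop :=
  ContDiff ℝ ∞ (fun p : E n × E n => a p.1 p.2) ∧
  ∀ l k : ℕ, ∃ C : ℝ, ∀ x ξ : E n,
    ‖iteratedFDeriv ℝ l (fun x' : E n => iteratedFDeriv ℝ k (fun ξ' : E n => a x' ξ') ξ) x‖
      ≤ C * (1 + ‖ξ‖) ^ (m - ρ * (k : ℝ) + δ * (l : ℝ))

/-- The Fourier transform `∫ e^{-i y·ξ} f(y) dy`, in terms of Mathlib's `𝓕`, whose kernel
is `e^{-2π i y·ξ}`. -/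
def fourier {n : ℕ} (f : E n → ℂ) (ξ : E n) : ℂ :=
  (𝓕 f) ((2 * Real.pi)⁻¹ • ξ)

/-- The pseudodifferential operator
`T_a f(x) = (2π)^{-n} ∫ e^{i x·ξ} a(x, ξ) (∫ e^{-i y·ξ} f(y) dy) dξ`. -/
def pseudo {n : ℕ} (a : E n → E n → ℂ) (f : E n → ℂ) (x : E n) : ℂ :=
  (((2 * Real.pi) ^ n : ℝ) : ℂ)⁻¹ *
    ∫ ξ : E n, Complex.exp (Complex.I * ((inner ℝ x ξ : ℝ) : ℂ)) * a x ξ * fourier f ξ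

/-- The pairing `⟨F, g⟩ = ∫ F(x) conj(g(x)) dx`. -/
def pairing {n : ℕ} (F g : E n → ℂ) : ℂ :=
  ∫ x : E n, F x * starRingEnd ℂ (g x)

/-- A dyadic cube of one of the `3ⁿ` shifted dyadic grids: the cube with side `2 ^ k` and
lower corner `2 ^ k (c + v / 3)`, where `c ∈ ℤⁿ` and `v ∈ {0, 1, 2}ⁿ`. -/
structure DyadicCube (n : ℕ) where
  /-- the scale -/
  k : ℤ
  /-- the integer position -/
  c : Fin n → ℤ
  /-- the shift of the grid, in units of one third -/
  v : Fin n → Fin 3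

/-- The (half-open) cube as a subset of `ℝⁿ`. -/
def DyadicCube.toSet {n : ℕ} (Q : DyadicCube n) : Set (E n) :=
  {x | ∀ i, (2 : ℝ) ^ Q.k * ((Q.c i : ℝ) + ((Q.v i : ℕ) : ℝ) / 3) ≤ x i ∧
    x i < (2 : ℝ) ^ Q.k * ((Q.c i : ℝ) + ((Q.v i : ℕ) : ℝ) / 3 + 1)}

/-- The Lebesgue measure `|Q|`. -/
def DyadicCube.vol {n : ℕ} (Q : DyadicCube n) : ℝ≥0∞ :=
  MeasureTheory.volume Q.toSet

/-- A collection of dyadic cubes is `η`-sparse if there are pairwise disjoint measurable sets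
`A Q ⊆ Q` with `|A Q| > η |Q|`. -/
def IsSparse {n : ℕ} (η : ℝ) (S : Set (DyadicCube n)) : Prop :=
  ∃ A : DyadicCube n → Set (E n),
    (∀ Q ∈ S, MeasurableSet (A Q) ∧ A Q ⊆ Q.toSet ∧
      ENNReal.ofReal η * Q.vol < MeasureTheory.volume (A Q)) ∧
    S.PairwiseDisjoint A

/-- The average `⟨f⟩_{p,Q} = (|Q|⁻¹ ∫_Q |f|^p)^{1/p}`. -/
def avg {n : ℕ} (p : ℝ) (Q : DyadicCube n) (f : E n → ℂ) : ℝ≥0∞ :=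
  (Q.vol⁻¹ * ∫⁻ x in Q.toSet, ‖f x‖ₑ ^ p) ^ (1 / p)

/-- The sparse form `Λ_{S,p,q}(f, g) = ∑_{Q ∈ S} |Q| ⟨f⟩_{p,Q} ⟨g⟩_{q,Q}`, with values
in `[0, ∞]`. -/
def sparseForm {n : ℕ} (S : Set (DyadicCube n)) (p q : ℝ) (f g : E n → ℂ) : ℝ≥0∞ :=
  ∑' Q : S, Q.1.vol * avg p Q.1 f * avg q Q.1 g

/-- `T_a` satisfies a `(p, q)` sparse bound: for some `η ∈ (0, 1)` and some constant `C`, all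
`f` and `g` admit an `η`-sparse collection `S` with `|⟨T_a f, g⟩| ≤ C Λ_{S,p,q}(f, g)`.
The bound is only asked for smooth compactly supported `f` and `g`, where `T_a f` is given by
the absolutely convergent integral; a bound for all bounded compactly supported functions is
a stronger property, so that the failure of the present one is the stronger failure. -/
def HasSparseBound {n : ℕ} (a : E n → E n → ℂ) (p q : ℝ) : Prop :=
  ∃ η : ℝ, 0 < η ∧ η < 1 ∧ ∃ C : ℝ, ∀ f g : E n → ℂ,
    ContDiff ℝ ∞ f → HasCompactSupport f → ContDiff ℝ ∞ g → HasCompactSupport g →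
    ∃ S : Set (DyadicCube n), IsSparse η S ∧
      ‖pairing (pseudo a f) g‖ₑ ≤ ENNReal.ofReal C * sparseForm S p q f g

open Classical in
/-- The vertices `v₁, v₂, v₃, v₄` of the trapezoid, for `-n(1-ρ) ≤ m < 0`. -/
def vertices (n : ℕ) (m ρ : ℝ) : Set (ℝ × ℝ) :=
  if m ≤ -(n * (1 - ρ)) / 2 then
    {(1, 0), (1, -m / (n * (1 - ρ))), (-m / (n * (1 - ρ)), 1), (0, 1)}
  else
    {(1 / 2 + -m / (n * (1 - ρ)), 1 / 2 + m / (n * (1 - ρ))),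
      (1 / 2 + -m / (n * (1 - ρ)), 1 / 2),
      (1 / 2, 1 / 2 + -m / (n * (1 - ρ))),
      (1 / 2 + m / (n * (1 - ρ)), 1 / 2 + -m / (n * (1 - ρ)))}

/-- The open trapezoid `𝒯_{m,ρ,n}` with these vertices. -/
def trapezoid (n : ℕ) (m ρ : ℝ) : Set (ℝ × ℝ) :=
  interior (convexHull ℝ (vertices n m ρ))

end PseudoSparse

end

/-! Write `μ = -m / (n (1 - ρ))`, `u = 1/r`, `w = 1/s'`. Within `u, w ≤ 1 < u + w`, a point outside
the closed trapezoid violates `u + w ≤ 1 + μ`, `u ≤ 1/2 + μ` or `w ≤ 1/2 + μ`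
(`exponents_of_notMem_closure_trapezoid`). Each violation is excluded by a family of Fourier
multipliers, and one symbol contains all of them.

At frequency `R`, the multiplier is `R^m B(R^{-ρ} ξ)` times a cutoff at scale `R`. If the
derivatives of `B` are bounded uniformly in `R`, so are the symbol constants
(`exists_norm_iteratedFDeriv_blockSymbol_le`). Placing the multiplier for `R = 2^j` near the point
`10 j e` gives a single symbol (`isSymbol_gluedSymbol`) which equals the `j`-th multiplier on a ball
of radius 2. Even `j` carry plane waves, odd `j` chirps.

A plane wave translates by `R^{-ρ}`. Tested on two bumps of radius `R^{-1}` displaced by that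
vector, it gives a pairing of size `R^{m-n}`, while every sparse form is `O(d^n
(R^{-1}/d)^{n(u+w)})` with `d = R^{-ρ}`. Letting `R → ∞` forces `u + w ≤ 1 + μ`.

For the chirp, `B = Λ^{n/2} 𝓕(e^{iΛ|y|²} bump)` with `Λ = ε R^{1-ρ}`, up to rescaling the frequency
by `2π`. The quadratic phase makes this Fourier transform and all its derivatives `O(Λ^{-n/2})`, so
`B` is admissible. Tested on a bump of radius `R^{-1}` and the same chirp at radius `R^{-ρ}`, it
gives at least a constant times `R^{m-n} Λ^{n/2}`, because a fixed share of the `L²` mass of the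
chirp lies at frequencies below a multiple of `Λ` (`exists_le_norm_integral_chirpBump`). The sparse
form is `O(R^{-ρn} R^{-n(1-ρ)u})`, which forces `u ≤ 1/2 + μ`. Exchanging the two test functions
gives the condition on `w`.

The upper bounds on sparse forms are uniform over all sparse collections: a sparse form is at most
`η⁻¹` times the integral of a bilinear maximal function (`IsSparse.sparseForm_le`), which for bumps
has an explicit power-law majorant. -/

namespace PseudoSparse

/-! ### Geometry of the trapezoid -/

/-- The trapezoid with top side on `u + w = 1 + μ`, bounded by `u ≤ M` and `w ≤ M`. -/
lemma mem_convexHull_trapezoid {M μ u w : ℝ} (hμ : 0 < μ) (hM : μ ≤ 2 * M - 1)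
    (h1 : 1 ≤ u + w) (h2 : u + w ≤ 1 + μ) (hu : u ≤ M) (hw : w ≤ M) :
    (u, w) ∈ convexHull ℝ
      ({(M, 1 - M), (M, 1 - M + μ), (1 - M + μ, M), (1 - M, M)} : Set (ℝ × ℝ)) := by
  set V : Set (ℝ × ℝ) := {(M, 1 - M), (M, 1 - M + μ), (1 - M + μ, M), (1 - M, M)} with hV
  have hc : Convex ℝ (convexHull ℝ V) := convex_convexHull ℝ V
  have v1 : (M, 1 - M) ∈ convexHull ℝ V := subset_convexHull ℝ V (by simp [hV])
  have v2 : (M, 1 - M + μ) ∈ convexHull ℝ V := subset_convexHull ℝ V (by simp [hV])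
  have v3 : (1 - M + μ, M) ∈ convexHull ℝ V := subset_convexHull ℝ V (by simp [hV])
  have v4 : (1 - M, M) ∈ convexHull ℝ V := subset_convexHull ℝ V (by simp [hV])
  have q0 : 0 ≤ (u + w - 1) / μ := div_nonneg (by linarith) hμ.le
  have q1 : (u + w - 1) / μ ≤ 1 := by rw [div_le_one hμ]; linarith
  have qe : (u + w - 1) / μ * μ = u + w - 1 := div_mul_cancel₀ _ hμ.ne'
  have e1 : (M, u + w - M) ∈ convexHull ℝ V := by
    have := hc v1 v2 (sub_nonneg.2 q1) q0 (by ring)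
    convert this using 1
    ext
    · simp; ring
    · simp; linear_combination -qe
  have e2 : (u + w - M, M) ∈ convexHull ℝ V := by
    have := hc v4 v3 (sub_nonneg.2 q1) q0 (by ring)
    convert this using 1
    ext
    · simp; linear_combination -qe
    · simp; ring
  -- On the line through `(u, w)` of slope `-1`, the points `e1` and `e2` are the ends of the slice.
  -- They coincide exactly when `u + w = 2M`, and then `u = w = M`.
  rcases (show u + w ≤ 2 * M by linarith).eq_or_lt with h | h
  · convert e1 using 2 <;> linarith
  · have d : 0 < 2 * M - (u + w) := by linarith
    have p0 : 0 ≤ (M - w) / (2 * M - (u + w)) := div_nonneg (by linarith) d.le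
    have p1 : (M - w) / (2 * M - (u + w)) ≤ 1 := by rw [div_le_one d]; linarith
    have pe : (M - w) / (2 * M - (u + w)) * (2 * M - (u + w)) = M - w := div_mul_cancel₀ _ d.ne'
    have := hc e1 e2 p0 (sub_nonneg.2 p1) (by ring)
    convert this using 1
    ext
    · simp; linear_combination -pe
    · simp; linear_combination pe

/-- A convex set with nonempty interior has the same closure as its interior, so the four weak
inequalities still suffice after passing to the open trapezoid. -/
lemma mem_closure_interior_trapezoid {M μ u w : ℝ} (hμ : 0 < μ) (hM : μ ≤ 2 * M - 1)
    (h1 : 1 ≤ u + w) (h2 : u + w ≤ 1 + μ) (hu : u ≤ M) (hw : w ≤ M) :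
    (u, w) ∈ closure (interior (convexHull ℝ
      ({(M, 1 - M), (M, 1 - M + μ), (1 - M + μ, M), (1 - M, M)} : Set (ℝ × ℝ)))) := by
  rw [(convex_convexHull ℝ _).closure_interior_eq_closure_of_nonempty_interior]
  · exact subset_closure (mem_convexHull_trapezoid hμ hM h1 h2 hu hw)
  · refine ⟨(1 / 2 + μ / 4, 1 / 2 + μ / 4), ?_⟩
    rw [mem_interior]
    refine ⟨{p | 1 < p.1 + p.2 ∧ p.1 + p.2 < 1 + μ ∧ p.1 < M ∧ p.2 < M}, ?_, ?_, ?_⟩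
    · rintro ⟨a, b⟩ ⟨ha, hb, hc, hd⟩
      exact mem_convexHull_trapezoid hμ hM ha.le hb.le hc.le hd.le
    · exact (isOpen_lt (f := fun _ : ℝ × ℝ => (1 : ℝ)) (g := fun p => p.1 + p.2)
        (by fun_prop) (by fun_prop)).inter
        ((isOpen_lt (f := fun p : ℝ × ℝ => p.1 + p.2) (g := fun _ => 1 + μ)
        (by fun_prop) (by fun_prop)).inter
        ((isOpen_lt (f := fun p : ℝ × ℝ => p.1) (g := fun _ => M) (by fun_prop) (by fun_prop)).inter
        (isOpen_lt (f := fun p : ℝ × ℝ => p.2) (g := fun _ => M) (by fun_prop) (by fun_prop))))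
    · refine ⟨?_, ?_, ?_, ?_⟩ <;> dsimp only <;> linarith

/-- A point above the duality line outside the closed trapezoid violates one of three
inequalities. -/
lemma exponents_of_notMem_closure_trapezoid {n : ℕ} (hn : 0 < n) {m ρ : ℝ} (hρ : ρ < 1)
    (hm : -((n : ℝ) * (1 - ρ)) ≤ m) (hm0 : m < 0) {u w : ℝ} (hu : u ≤ 1) (hw : w ≤ 1)
    (huw : 1 < u + w) (h : (u, w) ∉ closure (trapezoid n m ρ)) :
    1 + -m / (n * (1 - ρ)) < u + w ∨ 1 / 2 + -m / (n * (1 - ρ)) < u ∨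
      1 / 2 + -m / (n * (1 - ρ)) < w := by
  have hd : (0 : ℝ) < n * (1 - ρ) := mul_pos (by exact_mod_cast hn) (by linarith)
  set μ : ℝ := -m / (n * (1 - ρ)) with hμ
  have hμ0 : 0 < μ := div_pos (by linarith) hd
  have hμ1 : μ ≤ 1 := by rw [hμ, div_le_one hd]; linarith
  have hmμ : m / (n * (1 - ρ)) = -μ := by rw [hμ]; ring
  by_contra! hcon
  obtain ⟨c1, c2, c3⟩ := hcon
  apply h
  unfold trapezoid vertices
  rw [hmμ, ← hμ]
  split_ifs with hc
  -- Both vertex lists are one family: `M = 1` for `μ ≥ 1/2`, where the side conditions are just `u,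
  -- w ≤ 1`, and `M = 1/2 + μ` otherwise.
  · have := mem_closure_interior_trapezoid (M := 1) hμ0 (by linarith) huw.le c1 hu hw
    simpa using this
  · have : μ < 1 / 2 := by rw [hμ, div_lt_iff₀ hd]; linarith
    have := mem_closure_interior_trapezoid (M := 1 / 2 + μ) hμ0 (by linarith) huw.le c1 c2 c3
    have e : 1 - (1 / 2 + μ) = 1 / 2 + -μ := by ring
    have e' : 1 / 2 + -μ + μ = 1 / 2 := by ring
    rw [e, e'] at this
    exact this

/-! ### Dyadic cubes and domination of sparse forms by a maximal function -/

open MeasureTheory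

variable {n : ℕ}

/-- The lower corner of a dyadic cube. -/
noncomputable def DyadicCube.corner (Q : DyadicCube n) (i : Fin n) : ℝ :=
  (2 : ℝ) ^ Q.k * ((Q.c i : ℝ) + ((Q.v i : ℕ) : ℝ) / 3)

lemma DyadicCube.toSet_eq_preimage (Q : DyadicCube n) :
    Q.toSet = (WithLp.ofLp : E n → Fin n → ℝ) ⁻¹'
      (Set.univ.pi fun i => Set.Ico (Q.corner i) (Q.corner i + (2 : ℝ) ^ Q.k)) := by
  ext x
  simp only [toSet, corner, Set.mem_ofPred_eq, Set.mem_preimage, Set.mem_pi, Set.mem_univ,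
    true_implies, Set.mem_Ico, mul_add, mul_one]

lemma DyadicCube.vol_eq (Q : DyadicCube n) : Q.vol = ENNReal.ofReal (((2 : ℝ) ^ Q.k) ^ n) := by
  rw [vol, toSet_eq_preimage, (PiLp.volume_preserving_ofLp (Fin n)).measure_preimage
    (MeasurableSet.univ_pi fun i => measurableSet_Ico).nullMeasurableSet, Real.volume_pi_Ico]
  simp [ENNReal.ofReal_pow (zpow_nonneg (zero_le_two (α := ℝ)) Q.k)]

lemma DyadicCube.vol_ne_zero (Q : DyadicCube n) : Q.vol ≠ 0 := by
  rw [vol_eq]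
  simpa using (by positivity : 0 < ((2 : ℝ) ^ Q.k) ^ n)

lemma DyadicCube.vol_ne_top (Q : DyadicCube n) : Q.vol ≠ ⊤ := by
  rw [vol_eq]; exact ENNReal.ofReal_ne_top

lemma DyadicCube.norm_sub_le (Q : DyadicCube n) {x y : E n} (hx : x ∈ Q.toSet)
    (hy : y ∈ Q.toSet) : ‖x - y‖ ≤ √n * (2 : ℝ) ^ Q.k := by
  have h0 : (0 : ℝ) ≤ (2 : ℝ) ^ Q.k := by positivity
  rw [EuclideanSpace.norm_eq, ← Real.sqrt_sq h0, ← Real.sqrt_mul (Nat.cast_nonneg n)]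
  apply Real.sqrt_le_sqrt
  calc ∑ i, ‖(x - y) i‖ ^ 2 ≤ ∑ _i : Fin n, ((2 : ℝ) ^ Q.k) ^ 2 := by
        refine Finset.sum_le_sum fun i _ => ?_
        have h1 := hx i
        have h2 := hy i
        rw [mul_add _ _ (1 : ℝ)] at h1 h2
        refine pow_le_pow_left₀ (norm_nonneg _) ?_ 2
        rw [Real.norm_eq_abs, PiLp.sub_apply, abs_le]
        constructor <;> linarith [h1.1, h1.2, h2.1, h2.2]
    _ = _ := by simp

instance : Countable (DyadicCube n) :=
  Function.Injective.countable (f := fun Q : DyadicCube n => (Q.k, Q.c, Q.v)) (by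
    rintro ⟨k, c, v⟩ ⟨k', c', v'⟩ h
    simp only [Prod.mk.injEq] at h
    obtain ⟨rfl, rfl, rfl⟩ := h
    rfl)

lemma sparseForm_comm (S : Set (DyadicCube n)) (p q : ℝ) (f g : E n → ℂ) :
    sparseForm S p q f g = sparseForm S q p g f := by
  unfold sparseForm
  exact tsum_congr fun Q => by ring

/-- A sparse form is dominated by the integral of the associated bilinear maximal function. -/
lemma IsSparse.sparseForm_le {η : ℝ} (hη : 0 < η) {S : Set (DyadicCube n)} (hS : IsSparse η S)
    {p q : ℝ} {f g : E n → ℂ} {H : E n → ℝ≥0∞}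
    (hH : ∀ᵐ x, ∀ Q : DyadicCube n, x ∈ Q.toSet → avg p Q f * avg q Q g ≤ H x) :
    sparseForm S p q f g ≤ (ENNReal.ofReal η)⁻¹ * ∫⁻ x, H x := by
  obtain ⟨A, hA, hd⟩ := hS
  have hη0 : ENNReal.ofReal η ≠ 0 := by simpa using hη
  have hηt : ENNReal.ofReal η ≠ ⊤ := ENNReal.ofReal_ne_top
  have key : ∀ Q : S, Q.1.vol * avg p Q.1 f * avg q Q.1 g ≤
      (ENNReal.ofReal η)⁻¹ * ∫⁻ x in A Q.1, H x := by
    rintro ⟨Q, hQ⟩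
    obtain ⟨hm, hsub, hlt⟩ := hA Q hQ
    -- Sparseness trades `|Q|` for `η⁻¹ |A Q|`; disjointness of the sets `A Q` later merges the sum
    -- into one integral.
    have h1 : Q.vol ≤ (ENNReal.ofReal η)⁻¹ * volume (A Q) := by
      calc Q.vol = (ENNReal.ofReal η)⁻¹ * (ENNReal.ofReal η * Q.vol) := by
            rw [← mul_assoc, ENNReal.inv_mul_cancel hη0 hηt, one_mul]
        _ ≤ _ := by gcongr
    have h2 : volume (A Q) * (avg p Q f * avg q Q g) ≤ ∫⁻ x in A Q, H x := by
      rw [mul_comm, ← setLIntegral_const]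
      refine setLIntegral_mono_ae' hm ?_
      filter_upwards [hH] with x hx hxA using hx Q (hsub hxA)
    calc Q.vol * avg p Q f * avg q Q g
        ≤ ((ENNReal.ofReal η)⁻¹ * volume (A Q)) * (avg p Q f * avg q Q g) := by
          rw [mul_assoc]; gcongr
      _ ≤ _ := by rw [mul_assoc]; gcongr
  calc sparseForm S p q f g ≤ ∑' Q : S, (ENNReal.ofReal η)⁻¹ * ∫⁻ x in A Q.1, H x :=
        ENNReal.tsum_le_tsum key
    _ = (ENNReal.ofReal η)⁻¹ * ∫⁻ x in ⋃ Q : S, A Q.1, H x := by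
        rw [ENNReal.tsum_mul_left, lintegral_iUnion (fun Q : S => (hA Q.1 Q.2).1)]
        intro Q Q' hne
        exact hd Q.2 Q'.2 fun h => hne (Subtype.ext h)
    _ ≤ _ := by gcongr; exact Measure.restrict_le_self

/-! ### Averages of bumps over cubes -/

lemma avg_le_rpow {p : ℝ} (hp : 1 ≤ p) {Q : DyadicCube n} {f : E n → ℂ} (hf : ∀ x, ‖f x‖ ≤ 1)
    {B : Set (E n)} (hB : MeasurableSet B) (hfB : ∀ x ∉ B, f x = 0) :
    avg p Q f ≤ (Q.vol⁻¹ * volume (B ∩ Q.toSet)) ^ (1 / p) := by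
  unfold avg
  refine ENNReal.rpow_le_rpow ?_ (by positivity)
  gcongr
  have h : ∀ x, ‖f x‖ₑ ^ p ≤ B.indicator (1 : E n → ℝ≥0∞) x := by
    intro x
    by_cases hx : x ∈ B
    · simp only [hx, Set.indicator_of_mem, Pi.one_apply]
      refine ENNReal.rpow_le_one ?_ (by linarith)
      rw [← ofReal_norm]; exact ENNReal.ofReal_le_one.2 (hf x)
    · simp [hfB x hx, hx, ENNReal.zero_rpow_of_pos (by linarith : 0 < p)]
  refine (lintegral_mono h).trans_eq ?_
  rw [lintegral_indicator_one hB, Measure.restrict_apply hB]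

lemma avg_le_one {p : ℝ} (hp : 1 ≤ p) {Q : DyadicCube n} {f : E n → ℂ} (hf : ∀ x, ‖f x‖ ≤ 1) :
    avg p Q f ≤ 1 := by
  refine (avg_le_rpow hp hf MeasurableSet.univ (by simp)).trans (ENNReal.rpow_le_one ?_ (by positivity))
  rw [Set.univ_inter]
  exact (ENNReal.inv_mul_cancel Q.vol_ne_zero Q.vol_ne_top).le

/-- The constant relating averages of bumps to the distance from their centers. -/
noncomputable def bumpConst (n : ℕ) : ℝ := 2 * √n * (1 + (volume : Measure (E n)).real (Metric.ball 0 1)) + 2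

lemma two_le_bumpConst (n : ℕ) : 2 ≤ bumpConst n := by
  have : 0 ≤ 2 * √n * (1 + (volume : Measure (E n)).real (Metric.ball 0 1)) := by positivity
  unfold bumpConst; linarith

/-- A cube containing `x` and meeting the ball of radius `α` about `c` has side at least a multiple
of `‖x - c‖` once `‖x - c‖ ≥ 2α`, so the ball fills only a fraction `(α / ‖x - c‖)^n` of it, up to
constants. The exponent may be lowered from `1 / p` to `u`; this keeps the later integrals finite
when `p = 1`. -/
lemma avg_le_of_support (hn : 0 < n) {p : ℝ} (hp : 1 ≤ p) {Q : DyadicCube n} {f : E n → ℂ}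
    (hf : ∀ x, ‖f x‖ ≤ 1) {c : E n} {α : ℝ} (hα : 0 < α)
    (hfB : ∀ x ∉ Metric.closedBall c α, f x = 0) {u : ℝ} (hu : 0 ≤ u) (hup : u ≤ 1 / p)
    {x : E n} (hx : x ∈ Q.toSet) (hxc : x ≠ c) :
    avg p Q f ≤ ENNReal.ofReal ((bumpConst n * α / ‖x - c‖) ^ ((n : ℝ) * u)) := by
  have hC := two_le_bumpConst n
  have hd : 0 < ‖x - c‖ := norm_pos_iff.2 (sub_ne_zero.2 hxc)
  set t : ℝ := bumpConst n * α / ‖x - c‖ with ht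
  have ht0 : 0 < t := by positivity
  by_cases h1 : 1 ≤ t
  · refine (avg_le_one hp hf).trans ?_
    rw [ENNReal.one_le_ofReal]
    exact Real.one_le_rpow h1 (by positivity)
  push Not at h1
  refine (avg_le_rpow hp hf Metric.isClosed_closedBall.measurableSet hfB).trans ?_
  have key : Q.vol⁻¹ * volume (Metric.closedBall c α ∩ Q.toSet) ≤ ENNReal.ofReal (t ^ n) := by
    by_cases he : (Metric.closedBall c α ∩ Q.toSet).Nonempty
    · obtain ⟨y, hy, hyQ⟩ := he
      have hs : ‖x - c‖ ≤ √n * (2 : ℝ) ^ Q.k + α := by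
        calc ‖x - c‖ ≤ ‖x - y‖ + ‖y - c‖ := norm_sub_le_norm_sub_add_norm_sub ..
          _ ≤ _ := add_le_add (Q.norm_sub_le hx hyQ) (by simpa [dist_eq_norm] using hy)
      have h2 : 2 * α ≤ ‖x - c‖ := by
        rw [ht, div_lt_one hd] at h1
        nlinarith
      have h3 : ‖x - c‖ ≤ 2 * √n * (2 : ℝ) ^ Q.k := by linarith
      refine (mul_le_mul_right (measure_mono Set.inter_subset_left) _).trans ?_
      rw [← ENNReal.div_eq_inv_mul,
        ENNReal.div_le_iff Q.vol_ne_zero Q.vol_ne_top, Measure.addHaar_closedBall _ _ hα.le,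
        Q.vol_eq, finrank_euclideanSpace_fin, ← ENNReal.ofReal_mul (by positivity)]
      have hv : volume (Metric.ball (0 : E n) 1) =
          ENNReal.ofReal ((volume : Measure (E n)).real (Metric.ball 0 1)) := by
        rw [ofReal_measureReal]
      rw [hv, ← ENNReal.ofReal_mul (by positivity)]
      apply ENNReal.ofReal_le_ofReal
      set v : ℝ := (volume : Measure (E n)).real (Metric.ball 0 1) with hvdef
      have hv0 : 0 ≤ v := by positivity
      -- The volume of the unit ball is absorbed into an `n`-th power, so that it enters `bumpConst`
      -- as the factor `1 + v`.
      have hvn : v ≤ (1 + v) ^ n := by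
        calc v ≤ 1 + v := by linarith
          _ ≤ _ := le_self_pow₀ (by linarith) hn.ne'
      calc α ^ n * v ≤ α ^ n * (1 + v) ^ n := by gcongr
        _ = (α * (1 + v)) ^ n := by rw [mul_pow]
        _ ≤ (t * (2 : ℝ) ^ Q.k) ^ n := by
          refine pow_le_pow_left₀ (by positivity) ?_ n
          rw [ht, div_mul_eq_mul_div, le_div_iff₀ hd]
          calc α * (1 + v) * ‖x - c‖ ≤ α * (1 + v) * (2 * √n * (2 : ℝ) ^ Q.k) := by gcongr
            _ = (2 * √n * (1 + v)) * α * (2 : ℝ) ^ Q.k := by ring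
            _ ≤ bumpConst n * α * (2 : ℝ) ^ Q.k := by
              gcongr
              unfold bumpConst
              linarith
        _ = _ := by rw [mul_pow]
    · rw [Set.not_nonempty_iff_eq_empty.1 he]; simp
  calc (Q.vol⁻¹ * volume (Metric.closedBall c α ∩ Q.toSet)) ^ (1 / p)
      ≤ (ENNReal.ofReal (t ^ n)) ^ (1 / p) := ENNReal.rpow_le_rpow key (by positivity)
    _ = ENNReal.ofReal (t ^ ((n : ℝ) * (1 / p))) := by
        rw [ENNReal.ofReal_rpow_of_nonneg (by positivity) (by positivity), Real.rpow_mul ht0.le,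
          Real.rpow_natCast]
    _ ≤ _ := by
        apply ENNReal.ofReal_le_ofReal
        exact Real.rpow_le_rpow_of_exponent_ge ht0 h1.le (by gcongr)

/-! ### Sparse forms of two bumps -/

/-- The radial weight `|x|^{-a} min(1, |x|^{-b})`. -/
noncomputable def radialWeight (a b : ℝ) (x : E n) : ℝ := ‖x‖ ^ (-a) * min 1 (‖x‖ ^ (-b))

lemma radialWeight_nonneg (a b : ℝ) (x : E n) : 0 ≤ radialWeight a b x := by
  unfold radialWeight; positivity

lemma measurable_radialWeight (a b : ℝ) : Measurable (radialWeight (n := n) a b) := by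
  unfold radialWeight; fun_prop

/-- The singularity at the origin has order `a < n`, and the decay at infinity has order `a + b >
n`. -/
lemma integrable_radialWeight (hn : 0 < n) {a b : ℝ} (ha : a < n) (hab : n < a + b) :
    Integrable (radialWeight (n := n) a b) := by
  have hm := (measurable_radialWeight (n := n) a b).aestronglyMeasurable (μ := volume)
  have h1 : IntegrableOn (radialWeight (n := n) a b) (Metric.ball 0 1) := by
    refine integrableOn_ball_of_norm_le_rpow (C := 1) (α := a) (by simpa using Nat.succ_le_of_lt hn)
      (by simpa using ha) (Filter.Eventually.of_forall fun x => ?_) hm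
    rw [Real.norm_of_nonneg (radialWeight_nonneg a b x), one_mul, radialWeight]
    exact mul_le_of_le_one_right (by positivity) (min_le_left _ _)
  have h2 : IntegrableOn (radialWeight (n := n) a b) (Metric.ball 0 1)ᶜ := by
    have hi : Integrable (fun x : E n => (2 : ℝ) ^ (a + b) * (1 + ‖x‖) ^ (-(a + b))) :=
      (integrable_one_add_norm (by simpa using hab)).const_mul _
    refine Integrable.mono' hi.integrableOn hm.restrict ?_
    filter_upwards [ae_restrict_mem Metric.isOpen_ball.measurableSet.compl] with x hx
    have hx1 : 1 ≤ ‖x‖ := by simpa using hx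
    have h0 : 0 < ‖x‖ := by linarith
    have hs : 0 ≤ a + b := (Nat.cast_nonneg n).trans hab.le
    rw [Real.norm_of_nonneg (radialWeight_nonneg a b x), radialWeight]
    calc ‖x‖ ^ (-a) * min 1 (‖x‖ ^ (-b)) ≤ ‖x‖ ^ (-a) * ‖x‖ ^ (-b) := by
          gcongr; exact min_le_right _ _
      _ = ‖x‖ ^ (-(a + b)) := by rw [← Real.rpow_add h0]; ring_nf
      _ ≤ ((1 + ‖x‖) / 2) ^ (-(a + b)) :=
          Real.rpow_le_rpow_of_nonpos (by positivity) (by linarith) (by linarith)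
      _ = _ := by
          rw [Real.div_rpow (by linarith) (by norm_num), Real.rpow_neg zero_le_two (a + b),
            div_inv_eq_mul, mul_comm]
  have := h1.union h2
  rwa [Set.union_compl_self, integrableOn_univ] at this

lemma lintegral_comp_inv_smul_sub {F : E n → ℝ≥0∞} (hF : Measurable F) (c : E n) {d : ℝ}
    (hd : 0 < d) : ∫⁻ x, F (d⁻¹ • (x - c)) = ENNReal.ofReal (d ^ n) * ∫⁻ x, F x := by
  have h1 : ∫⁻ x, F (d⁻¹ • (x - c)) = ∫⁻ x, F (d⁻¹ • x) :=
    lintegral_sub_right_eq_self (fun x => F (d⁻¹ • x)) c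
  rw [h1]
  have h2 := Measure.map_addHaar_smul (volume : Measure (E n)) (inv_ne_zero hd.ne')
  rw [← lintegral_map hF (measurable_const_smul d⁻¹), h2, lintegral_smul_measure,
    finrank_euclideanSpace_fin, inv_pow, inv_inv, abs_of_pos (by positivity), smul_eq_mul]

lemma lintegral_radialWeight_comp (hn : 0 < n) {a b : ℝ} (ha : a < n) (hab : n < a + b)
    {C : ℝ} (hC : 0 ≤ C) (c : E n) {d : ℝ} (hd : 0 < d) :
    ∫⁻ x, ENNReal.ofReal (C * radialWeight a b (d⁻¹ • (x - c))) =
      ENNReal.ofReal (C * (d ^ n * ∫ x : E n, radialWeight a b x)) := by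
  simp_rw [ENNReal.ofReal_mul hC]
  rw [lintegral_const_mul]
  · rw [lintegral_comp_inv_smul_sub (F := fun x => ENNReal.ofReal (radialWeight a b x))
      (measurable_radialWeight a b).ennreal_ofReal c hd,
      ← ofReal_integral_eq_lintegral_ofReal (integrable_radialWeight hn ha hab)
        (Filter.Eventually.of_forall (radialWeight_nonneg a b)),
      ENNReal.ofReal_mul (by positivity)]
  · exact ((measurable_radialWeight a b).comp
      ((measurable_id.sub_const c).const_smul d⁻¹)).ennreal_ofReal

lemma norm_inv_smul {d : ℝ} (hd : 0 < d) (x : E n) : ‖d⁻¹ • x‖ = ‖x‖ / d := by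
  rw [norm_smul, norm_inv, Real.norm_of_nonneg hd.le, inv_mul_eq_div]

/-- The sparse form of two bumps with a common center and radii `α` and `β`. -/
lemma exists_sparseForm_concentric_le (hn : 0 < n) {p q u w : ℝ} (hp : 1 ≤ p) (hq : 1 ≤ q)
    (hu0 : 0 ≤ u) (hu : u ≤ 1 / p) (hu1 : u < 1) (hw0 : 0 ≤ w) (hw : w ≤ 1 / q)
    (huw : 1 < u + w) :
    ∃ C : ℝ, ∀ (η : ℝ) (S : Set (DyadicCube n)) (f g : E n → ℂ) (c : E n) (α β : ℝ),
      0 < η → IsSparse η S → 0 < α → 0 < β → (∀ x, ‖f x‖ ≤ 1) → (∀ x, ‖g x‖ ≤ 1) →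
      (∀ x ∉ Metric.closedBall c α, f x = 0) → (∀ x ∉ Metric.closedBall c β, g x = 0) →
      sparseForm S p q f g ≤
        (ENNReal.ofReal η)⁻¹ * ENNReal.ofReal (C * (β ^ n * (α / β) ^ ((n : ℝ) * u))) := by
  have hn' : (0 : ℝ) < n := by exact_mod_cast hn
  have : Nonempty (Fin n) := ⟨⟨0, hn⟩⟩
  have : Nontrivial (E n) := inferInstance
  have hB2 := two_le_bumpConst n
  set B := bumpConst n with hB
  have ha : (n : ℝ) * u < n := by nlinarith
  have hab : (n : ℝ) < n * u + n * w := by nlinarith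
  refine ⟨B ^ ((n : ℝ) * u) * B ^ ((n : ℝ) * w) * ∫ x : E n, radialWeight (n * u) (n * w) x, ?_⟩
  intro η S f g c α β hη hS hα hβ hf hg hfc hgc
  have h0 : (0 : ℝ) ≤ B ^ ((n : ℝ) * u) * B ^ ((n : ℝ) * w) * (α / β) ^ ((n : ℝ) * u) := by
    positivity
  refine (hS.sparseForm_le hη (H := fun x => ENNReal.ofReal
    (B ^ ((n : ℝ) * u) * B ^ ((n : ℝ) * w) * (α / β) ^ ((n : ℝ) * u) *
      radialWeight (n * u) (n * w) (β⁻¹ • (x - c)))) ?_).trans_eq ?_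
  · filter_upwards [Measure.ae_ne volume c] with x hx Q hxQ
    have hd : 0 < ‖x - c‖ := norm_pos_iff.2 (sub_ne_zero.2 hx)
    have h1 := avg_le_of_support hn hp hf hα hfc hu0 hu hxQ hx
    -- The trivial bound 1 is kept for `g`: near the center the majorant then has only the
    -- singularity of order `n u < n`.
    have h2 : avg q Q g ≤ ENNReal.ofReal (min 1 ((B * β / ‖x - c‖) ^ ((n : ℝ) * w))) := by
      rw [ENNReal.ofReal_min]
      exact le_min (by simpa using avg_le_one hq hg)
        (avg_le_of_support hn hq hg hβ hgc hw0 hw hxQ hx)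
    refine (mul_le_mul' h1 h2).trans ?_
    rw [← ENNReal.ofReal_mul (by positivity)]
    apply ENNReal.ofReal_le_ofReal
    rw [radialWeight, norm_inv_smul hβ]
    set t := ‖x - c‖ / β with ht
    have ht0 : 0 < t := by positivity
    have e1 : bumpConst n * α / ‖x - c‖ = B * (α / β) * t⁻¹ := by
      rw [← hB, ht]; field_simp
    have e2 : B * β / ‖x - c‖ = B * t⁻¹ := by rw [ht]; field_simp
    rw [e1, e2, Real.mul_rpow (by positivity) (by positivity),
      Real.mul_rpow (by positivity) (by positivity), Real.mul_rpow (by positivity) (by positivity),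
      Real.inv_rpow ht0.le, Real.inv_rpow ht0.le, ← Real.rpow_neg ht0.le, ← Real.rpow_neg ht0.le]
    have h3 : min 1 (B ^ ((n : ℝ) * w) * t ^ (-((n : ℝ) * w))) ≤
        B ^ ((n : ℝ) * w) * min 1 (t ^ (-((n : ℝ) * w))) := by
      rw [mul_min_of_nonneg _ _ (by positivity), mul_one]
      gcongr
      exact Real.one_le_rpow (by linarith) (by positivity)
    calc _ ≤ B ^ ((n : ℝ) * u) * (α / β) ^ ((n : ℝ) * u) * t ^ (-((n : ℝ) * u)) *
          (B ^ ((n : ℝ) * w) * min 1 (t ^ (-((n : ℝ) * w)))) := by gcongr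
      _ = _ := by ring
  · rw [lintegral_radialWeight_comp hn ha hab h0 c hβ]
    congr 2
    ring

/-- The farther of two points at mutual distance 1 is at distance at least `1/2`, so the
singularities at the two centers never meet. -/
lemma mul_rpow_neg_le_radialWeight {a b : ℝ} (hb : 0 ≤ b) {y z : E n} (hyz : ‖y - z‖ = 1)
    (hy0 : y ≠ 0) (h : ‖y‖ ≤ ‖z‖) :
    ‖y‖ ^ (-a) * ‖z‖ ^ (-b) ≤ 2 ^ b * radialWeight a b y := by
  have hy : 0 < ‖y‖ := norm_pos_iff.2 hy0
  have h1 : (1 : ℝ) / 2 ≤ ‖z‖ := by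
    have := norm_sub_le y z
    linarith
  have h2 : ‖z‖ ^ (-b) ≤ 2 ^ b * min 1 (‖y‖ ^ (-b)) := by
    rw [mul_min_of_nonneg _ _ (by positivity), mul_one]
    refine le_min ?_ ?_
    · calc ‖z‖ ^ (-b) ≤ (1 / 2 : ℝ) ^ (-b) :=
            Real.rpow_le_rpow_of_nonpos (by norm_num) h1 (by linarith)
        _ = _ := by rw [one_div, Real.inv_rpow (by norm_num), Real.rpow_neg (by norm_num), inv_inv]
    · calc ‖z‖ ^ (-b) ≤ ‖y‖ ^ (-b) := Real.rpow_le_rpow_of_nonpos hy h (by linarith)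
        _ ≤ _ := le_mul_of_one_le_left (by positivity) (Real.one_le_rpow (by norm_num) hb)
  rw [radialWeight]
  calc ‖y‖ ^ (-a) * ‖z‖ ^ (-b) ≤ ‖y‖ ^ (-a) * (2 ^ b * min 1 (‖y‖ ^ (-b))) := by gcongr
    _ = _ := by ring

/-- The sparse form of two bumps of radius `α` whose centers are at distance `d`. -/
lemma exists_sparseForm_separated_le (hn : 0 < n) {p q u w : ℝ} (hp : 1 ≤ p) (hq : 1 ≤ q)
    (hu0 : 0 ≤ u) (hu : u ≤ 1 / p) (hu1 : u < 1) (hw0 : 0 ≤ w) (hw : w ≤ 1 / q) (hw1 : w < 1)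
    (huw : 1 < u + w) :
    ∃ C : ℝ, ∀ (η : ℝ) (S : Set (DyadicCube n)) (f g : E n → ℂ) (c c' : E n) (α d : ℝ),
      0 < η → IsSparse η S → 0 < α → 0 < d → ‖c - c'‖ = d →
      (∀ x, ‖f x‖ ≤ 1) → (∀ x, ‖g x‖ ≤ 1) →
      (∀ x ∉ Metric.closedBall c α, f x = 0) → (∀ x ∉ Metric.closedBall c' α, g x = 0) →
      sparseForm S p q f g ≤
        (ENNReal.ofReal η)⁻¹ *
          ENNReal.ofReal (C * (d ^ n * ((α / d) ^ ((n : ℝ) * u) * (α / d) ^ ((n : ℝ) * w)))) := by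
  have hn' : (0 : ℝ) < n := by exact_mod_cast hn
  have : Nonempty (Fin n) := ⟨⟨0, hn⟩⟩
  have : Nontrivial (E n) := inferInstance
  have hB2 := two_le_bumpConst n
  set B := bumpConst n with hB
  have ha : (n : ℝ) * u < n := by nlinarith
  have ha' : (n : ℝ) * w < n := by nlinarith
  have hab : (n : ℝ) < n * u + n * w := by nlinarith
  have hab' : (n : ℝ) < n * w + n * u := by nlinarith
  refine ⟨B ^ ((n : ℝ) * u) * B ^ ((n : ℝ) * w) *
    (2 ^ ((n : ℝ) * w) * ∫ x : E n, radialWeight (n * u) (n * w) x) +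
    B ^ ((n : ℝ) * u) * B ^ ((n : ℝ) * w) *
    (2 ^ ((n : ℝ) * u) * ∫ x : E n, radialWeight (n * w) (n * u) x), ?_⟩
  intro η S f g c c' α d hη hS hα hd hcc hf hg hfc hgc
  set K : ℝ := B ^ ((n : ℝ) * u) * B ^ ((n : ℝ) * w) *
    ((α / d) ^ ((n : ℝ) * u) * (α / d) ^ ((n : ℝ) * w)) with hK
  have hK0 : 0 ≤ K := by positivity
  refine (hS.sparseForm_le hη (H := fun x =>
    ENNReal.ofReal (K * 2 ^ ((n : ℝ) * w) * radialWeight (n * u) (n * w) (d⁻¹ • (x - c))) +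
    ENNReal.ofReal (K * 2 ^ ((n : ℝ) * u) * radialWeight (n * w) (n * u) (d⁻¹ • (x - c')))) ?_).trans_eq ?_
  · filter_upwards [Measure.ae_ne volume c, Measure.ae_ne volume c'] with x hx hx' Q hxQ
    have hdx : 0 < ‖x - c‖ := norm_pos_iff.2 (sub_ne_zero.2 hx)
    have hdx' : 0 < ‖x - c'‖ := norm_pos_iff.2 (sub_ne_zero.2 hx')
    have h1 := avg_le_of_support hn hp hf hα hfc hu0 hu hxQ hx
    have h2 := avg_le_of_support hn hq hg hα hgc hw0 hw hxQ hx'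
    refine (mul_le_mul' h1 h2).trans ?_
    rw [← ENNReal.ofReal_mul (by positivity), ← ENNReal.ofReal_add
      (mul_nonneg (by positivity) (radialWeight_nonneg _ _ _))
      (mul_nonneg (by positivity) (radialWeight_nonneg _ _ _))]
    apply ENNReal.ofReal_le_ofReal
    set y := d⁻¹ • (x - c) with hy
    set z := d⁻¹ • (x - c') with hz
    have hyz : ‖y - z‖ = 1 := by
      rw [hy, hz, ← smul_sub, sub_sub_sub_cancel_left, norm_inv_smul hd, norm_sub_rev, hcc,
        div_self hd.ne']
    have ny : ‖y‖ = ‖x - c‖ / d := norm_inv_smul hd _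
    have nz : ‖z‖ = ‖x - c'‖ / d := norm_inv_smul hd _
    have hy0 : 0 < ‖y‖ := by rw [ny]; positivity
    have hz0 : 0 < ‖z‖ := by rw [nz]; positivity
    have e1 : bumpConst n * α / ‖x - c‖ = B * (α / d) * ‖y‖⁻¹ := by
      rw [← hB, ny]; field_simp
    have e2 : bumpConst n * α / ‖x - c'‖ = B * (α / d) * ‖z‖⁻¹ := by
      rw [← hB, nz]; field_simp
    rw [e1, e2, Real.mul_rpow (by positivity) (by positivity),
      Real.mul_rpow (by positivity) (by positivity), Real.mul_rpow (by positivity) (by positivity),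
      Real.mul_rpow (by positivity) (by positivity),
      Real.inv_rpow hy0.le, Real.inv_rpow hz0.le, ← Real.rpow_neg hy0.le, ← Real.rpow_neg hz0.le]
    calc _ = K * (‖y‖ ^ (-((n : ℝ) * u)) * ‖z‖ ^ (-((n : ℝ) * w))) := by rw [hK]; ring
      _ ≤ K * (2 ^ ((n : ℝ) * w) * radialWeight (n * u) (n * w) y +
          2 ^ ((n : ℝ) * u) * radialWeight (n * w) (n * u) z) := by
        gcongr
        -- The weight at the nearer center dominates; adding both weights avoids splitting the
        -- domain of integration.
        rcases le_total ‖y‖ ‖z‖ with h | h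
        · exact (mul_rpow_neg_le_radialWeight (by positivity) hyz (norm_pos_iff.1 hy0) h).trans
            (le_add_of_nonneg_right (mul_nonneg (by positivity) (radialWeight_nonneg _ _ _)))
        · rw [mul_comm]
          exact (mul_rpow_neg_le_radialWeight (by positivity) (by rw [norm_sub_rev, hyz])
            (norm_pos_iff.1 hz0) h).trans
            (le_add_of_nonneg_left (mul_nonneg (by positivity) (radialWeight_nonneg _ _ _)))
      _ = _ := by ring
  · rw [lintegral_add_left, lintegral_radialWeight_comp hn ha hab (by positivity) c hd,
      lintegral_radialWeight_comp hn ha' hab' (by positivity) c' hd, ← ENNReal.ofReal_add]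
    · congr 2
      rw [hK]; ring
    · exact mul_nonneg (by positivity) (mul_nonneg (by positivity)
        (integral_nonneg (radialWeight_nonneg _ _)))
    · exact mul_nonneg (by positivity) (mul_nonneg (by positivity)
        (integral_nonneg (radialWeight_nonneg _ _)))
    · exact (((measurable_radialWeight _ _).comp
        ((measurable_id.sub_const c).const_smul d⁻¹)).const_mul _).ennreal_ofReal

/-! ### Symbol estimates for a single frequency block -/

lemma exists_norm_iteratedFDeriv_le_rpow {Φ : E n → ℂ} (hΦ : ContDiff ℝ ∞ Φ)
    (hc : HasCompactSupport Φ) (l : ℕ) (M : ℝ) :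
    ∃ C : ℝ, 0 ≤ C ∧ ∀ x, ‖iteratedFDeriv ℝ l Φ x‖ ≤ C * (1 + ‖x‖) ^ M := by
  have hcont : Continuous fun x : E n => (1 + ‖x‖) ^ (-M) • iteratedFDeriv ℝ l Φ x := by
    have h1 : Continuous (iteratedFDeriv ℝ l Φ) :=
      hΦ.continuous_iteratedFDeriv (by exact_mod_cast le_top)
    have h2 : Continuous fun x : E n => (1 + ‖x‖) ^ (-M) :=
      (continuous_const.add continuous_norm).rpow_const fun x =>
        Or.inl (add_pos_of_pos_of_nonneg one_pos (norm_nonneg x)).ne'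
    exact h2.smul h1
  obtain ⟨C, hC⟩ := (hc.iteratedFDeriv (𝕜 := ℝ) l).smul_left
    (f := fun x : E n => (1 + ‖x‖) ^ (-M)) |>.exists_bound_of_continuous hcont
  refine ⟨max C 0, le_max_right _ _, fun x => ?_⟩
  have h := hC x
  have h0 : 0 < 1 + ‖x‖ := by positivity
  simp only [Pi.smul_apply', norm_smul] at h
  rw [Real.norm_of_nonneg (by positivity), Real.rpow_neg h0.le,
    inv_mul_le_iff₀ (by positivity)] at h
  calc _ ≤ (1 + ‖x‖) ^ M * C := h
    _ ≤ max C 0 * (1 + ‖x‖) ^ M := by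
      rw [mul_comm]; gcongr; exact le_max_left _ _

lemma norm_iteratedFDeriv_comp_smul {F : Type*} [NormedAddCommGroup F] [NormedSpace ℝ F]
    {f : E n → F} (hf : ContDiff ℝ ∞ f) {t : ℝ} (ht : 0 ≤ t) (k : ℕ) (x : E n) :
    ‖iteratedFDeriv ℝ k (fun z => f (t • z)) x‖ = t ^ k * ‖iteratedFDeriv ℝ k f (t • x)‖ := by
  rw [iteratedFDeriv_comp_const_smul t (hf.of_le (by exact_mod_cast le_top)), norm_smul,
    Real.norm_of_nonneg (by positivity)]

/-- A symbol living at frequencies `≲ R`, modulated at scale `R ^ ρ`. -/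
noncomputable def blockSymbol (m ρ R : ℝ) (B Φ : E n → ℂ) (ξ : E n) : ℂ :=
  R ^ m • (B (R ^ (-ρ) • ξ) * Φ (R⁻¹ • ξ))

lemma contDiff_blockSymbol {m ρ R : ℝ} {B Φ : E n → ℂ} (hB : ContDiff ℝ ∞ B)
    (hΦ : ContDiff ℝ ∞ Φ) : ContDiff ℝ ∞ (blockSymbol m ρ R B Φ) := by
  unfold blockSymbol
  fun_prop

/-- Block symbols satisfy uniform symbol estimates. -/
lemma exists_norm_iteratedFDeriv_blockSymbol_le {ι : Type*} {m ρ : ℝ} (hm : m ≤ 0) (hρ0 : 0 ≤ ρ)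
    (hρ1 : ρ ≤ 1) {R : ι → ℝ} (hR : ∀ i, 1 ≤ R i) {B : ι → E n → ℂ}
    (hB : ∀ i, ContDiff ℝ ∞ (B i))
    (hBb : ∀ k : ℕ, ∃ C : ℝ, ∀ i η, ‖iteratedFDeriv ℝ k (B i) η‖ ≤ C)
    {Φ : E n → ℂ} (hΦ : ContDiff ℝ ∞ Φ) (hc : HasCompactSupport Φ) (k : ℕ) :
    ∃ C : ℝ, 0 ≤ C ∧ ∀ i ξ, ‖iteratedFDeriv ℝ k (blockSymbol m ρ (R i) (B i) Φ) ξ‖ ≤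
      C * (1 + ‖ξ‖) ^ (m - ρ * k) := by
  choose CB hCB using hBb
  choose CΦ hCΦ0 hCΦ using fun l => exists_norm_iteratedFDeriv_le_rpow hΦ hc l (m - ρ * k)
  refine ⟨∑ i ∈ Finset.range (k + 1), (k.choose i : ℝ) * |CB i| * CΦ (k - i),
    Finset.sum_nonneg fun i _ => by have := hCΦ0 (k - i); positivity, fun i ξ => ?_⟩
  have hR0 : 0 < R i := by linarith [hR i]
  have hM : m - ρ * k ≤ 0 := by
    have : 0 ≤ ρ * k := by positivity
    linarith
  have s1 : ContDiff ℝ ∞ fun ξ : E n => B i ((R i) ^ (-ρ) • ξ) := by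
    have := hB i; fun_prop
  have s2 : ContDiff ℝ ∞ fun ξ : E n => Φ ((R i)⁻¹ • ξ) := by fun_prop
  have hmul : ContDiff ℝ ∞ fun ξ : E n => B i ((R i) ^ (-ρ) • ξ) * Φ ((R i)⁻¹ • ξ) := s1.mul s2
  have e : blockSymbol m ρ (R i) (B i) Φ =
      fun ξ => (R i) ^ m • (B i ((R i) ^ (-ρ) • ξ) * Φ ((R i)⁻¹ • ξ)) := rfl
  rw [e, iteratedFDeriv_const_smul_apply' (hmul.contDiffAt.of_le (by exact_mod_cast le_top)),
    norm_smul, Real.norm_of_nonneg (by positivity)]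
  -- `R + ‖ξ‖ ≥ 1 + ‖ξ‖` and the exponent is nonpositive, so decay in `ξ / R` together with the
  -- power of `R` gives decay in `ξ`.
  have hdec : (R i) ^ (m - ρ * k) * (1 + ‖(R i)⁻¹ • ξ‖) ^ (m - ρ * k) ≤
      (1 + ‖ξ‖) ^ (m - ρ * k) := by
    rw [← Real.mul_rpow hR0.le (by positivity)]
    refine Real.rpow_le_rpow_of_nonpos (by positivity) ?_ hM
    rw [norm_inv_smul hR0, mul_add, mul_one, mul_div_cancel₀ _ hR0.ne']
    linarith [hR i]
  have key : ∀ j ∈ Finset.range (k + 1), (k.choose j : ℝ) *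
      ‖iteratedFDeriv ℝ j (fun ξ => B i ((R i) ^ (-ρ) • ξ)) ξ‖ *
      ‖iteratedFDeriv ℝ (k - j) (fun ξ => Φ ((R i)⁻¹ • ξ)) ξ‖ ≤
      (k.choose j : ℝ) * |CB j| * CΦ (k - j) *
        ((R i) ^ (-(ρ * k)) * (1 + ‖(R i)⁻¹ • ξ‖) ^ (m - ρ * k)) := by
    intro j hj
    have hjk : j ≤ k := Nat.lt_succ_iff.1 (Finset.mem_range.1 hj)
    rw [norm_iteratedFDeriv_comp_smul (hB i) (by positivity),
      norm_iteratedFDeriv_comp_smul hΦ (by positivity)]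
    -- A derivative falling on the cutoff gains `R^{-1}`, which is at least as good as `R^{-ρ}`.
    have hpow : ((R i) ^ (-ρ)) ^ j * ((R i)⁻¹) ^ (k - j) ≤ (R i) ^ (-(ρ * k)) := by
      rw [← Real.rpow_natCast, ← Real.rpow_natCast, ← Real.rpow_neg_one, ← Real.rpow_mul hR0.le,
        ← Real.rpow_mul hR0.le, ← Real.rpow_add hR0]
      refine Real.rpow_le_rpow_of_exponent_le (hR i) ?_
      rw [Nat.cast_sub hjk]
      have : (0 : ℝ) ≤ (1 - ρ) * (k - j) :=
        mul_nonneg (by linarith) (by simpa using hjk)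
      linarith
    calc _ = (k.choose j : ℝ) * ‖iteratedFDeriv ℝ j (B i) ((R i) ^ (-ρ) • ξ)‖ *
          ‖iteratedFDeriv ℝ (k - j) Φ ((R i)⁻¹ • ξ)‖ *
          (((R i) ^ (-ρ)) ^ j * ((R i)⁻¹) ^ (k - j)) := by ring
      _ ≤ (k.choose j : ℝ) * |CB j| * (CΦ (k - j) * (1 + ‖(R i)⁻¹ • ξ‖) ^ (m - ρ * k)) *
          (R i) ^ (-(ρ * k)) := by
        have := hCΦ0 (k - j)
        gcongr
        · exact (hCB j i _).trans (le_abs_self _)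
        · exact hCΦ (k - j) _
      _ = _ := by ring
  have hk := (norm_iteratedFDeriv_mul_le s1 s2 ξ (n := k) (by exact_mod_cast le_top)).trans
    (Finset.sum_le_sum key)
  rw [← Finset.sum_mul] at hk
  set A := ∑ j ∈ Finset.range (k + 1), (k.choose j : ℝ) * |CB j| * CΦ (k - j) with hA
  have hA0 : 0 ≤ A := Finset.sum_nonneg fun i _ => by have := hCΦ0 (k - i); positivity
  calc _ ≤ (R i) ^ m * (A * ((R i) ^ (-(ρ * k)) * (1 + ‖(R i)⁻¹ • ξ‖) ^ (m - ρ * k))) := by gcongr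
    _ = A * ((R i) ^ (m - ρ * k) * (1 + ‖(R i)⁻¹ • ξ‖) ^ (m - ρ * k)) := by
      rw [sub_eq_add_neg m, Real.rpow_add hR0]; ring
    _ ≤ _ := by gcongr

/-! ### Gluing the blocks in space -/

/-- A smooth cutoff equal to `1` on the ball of radius `2`. -/
noncomputable def spatialCutoff (n : ℕ) : ContDiffBump (0 : E n) where
  rIn := 2
  rOut := 3
  rIn_pos := by norm_num
  rIn_lt_rOut := by norm_num

/-- The sum of the multipliers `b j`, each localized in space around `10 j e`. -/
noncomputable def gluedSymbol (e : E n) (b : ℕ → E n → ℂ) (x ξ : E n) : ℂ :=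
  ∑' j : ℕ, spatialCutoff n (x - (10 * j : ℝ) • e) • b j ξ

lemma gluedSymbol_eq {e : E n} {b : ℕ → E n → ℂ} {x : E n} {j : ℕ}
    (hj : ∀ i ≠ j, spatialCutoff n (x - (10 * i : ℝ) • e) = 0) (ξ : E n) :
    gluedSymbol e b x ξ = spatialCutoff n (x - (10 * j : ℝ) • e) • b j ξ :=
  tsum_eq_single j fun i hi => by rw [hj i hi, zero_smul]

lemma spatialCutoff_eq_zero_of_ne {e : E n} (he : ‖e‖ = 1) {x : E n} {i j : ℕ} (hij : i ≠ j)
    (hj : ‖x - (10 * j : ℝ) • e‖ < 6) : spatialCutoff n (x - (10 * i : ℝ) • e) = 0 := by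
  refine (spatialCutoff n).zero_of_le_dist ?_
  rw [dist_zero_right]
  have h1 : (10 : ℝ) ≤ ‖(10 * i : ℝ) • e - (10 * j : ℝ) • e‖ := by
    rw [← sub_smul, norm_smul, he, mul_one, ← mul_sub, norm_mul, Real.norm_eq_abs, Real.norm_eq_abs]
    have : (1 : ℝ) ≤ |(i : ℝ) - j| := by
      exact_mod_cast Int.one_le_abs (sub_ne_zero.2 (show (i : ℤ) ≠ j by exact_mod_cast hij))
    rw [abs_of_pos (by norm_num : (0 : ℝ) < 10)]
    linarith
  have h2 : ‖(10 * i : ℝ) • e - (10 * j : ℝ) • e‖ ≤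
      ‖x - (10 * j : ℝ) • e‖ + ‖x - (10 * i : ℝ) • e‖ := by
    have := norm_sub_le (x - (10 * j : ℝ) • e) (x - (10 * i : ℝ) • e)
    rwa [sub_sub_sub_cancel_left] at this
  have h3 : (spatialCutoff n).rOut = 3 := rfl
  rw [h3]
  linarith

lemma gluedSymbol_eq_of_norm_le {e : E n} (he : ‖e‖ = 1) {b : ℕ → E n → ℂ} {x : E n} {j : ℕ}
    (hj : ‖x - (10 * j : ℝ) • e‖ ≤ 2) (ξ : E n) : gluedSymbol e b x ξ = b j ξ := by
  rw [gluedSymbol_eq fun i hi => spatialCutoff_eq_zero_of_ne he hi (by linarith),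
    (spatialCutoff n).one_of_mem_closedBall (mem_closedBall_zero_iff.2 hj), one_smul]

/-- The cutoffs have radius 3 and centers at mutual distance at least 10, so on a unit ball at most
one of them is nonzero. Hence smoothness and derivative bounds need only one term of the series. -/
lemma exists_eventually_gluedSymbol_eq {e : E n} (he : ‖e‖ = 1) (b : ℕ → E n → ℂ) (x : E n) :
    ∃ j : ℕ, ∀ᶠ y in nhds x, ∀ ξ,
      gluedSymbol e b y ξ = spatialCutoff n (y - (10 * j : ℝ) • e) • b j ξ := by
  by_cases h : ∃ j : ℕ, ‖x - (10 * j : ℝ) • e‖ < 5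
  · obtain ⟨j, hj⟩ := h
    refine ⟨j, ?_⟩
    filter_upwards [Metric.ball_mem_nhds x one_pos] with y hy ξ
    refine gluedSymbol_eq (fun i hi => spatialCutoff_eq_zero_of_ne he hi ?_) ξ
    have := norm_sub_le_norm_sub_add_norm_sub y x ((10 * j : ℝ) • e)
    rw [Metric.mem_ball, dist_eq_norm] at hy
    linarith
  · push Not at h
    -- Far from every center all terms vanish near `x`, and any index serves.
    refine ⟨0, ?_⟩
    filter_upwards [Metric.ball_mem_nhds x one_pos] with y hy ξ
    refine gluedSymbol_eq (fun i _ => (spatialCutoff n).zero_of_le_dist ?_) ξ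
    rw [dist_zero_right]
    have := norm_sub_le_norm_sub_add_norm_sub x y ((10 * i : ℝ) • e)
    rw [Metric.mem_ball, dist_comm, dist_eq_norm] at hy
    have h3 : (spatialCutoff n).rOut = 3 := rfl
    rw [h3]
    linarith [h i]

/-- Gluing multipliers with uniform symbol estimates yields a symbol. -/
lemma isSymbol_gluedSymbol {e : E n} (he : ‖e‖ = 1) {m ρ δ : ℝ} (hδ : 0 ≤ δ)
    {b : ℕ → E n → ℂ} (hb : ∀ j, ContDiff ℝ ∞ (b j))
    (hbb : ∀ k : ℕ, ∃ C : ℝ, 0 ≤ C ∧ ∀ j ξ, ‖iteratedFDeriv ℝ k (b j) ξ‖ ≤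
      C * (1 + ‖ξ‖) ^ (m - ρ * k)) :
    IsSymbol m ρ δ (gluedSymbol e b) := by
  have hφ : ContDiff ℝ ∞ (spatialCutoff n) := (spatialCutoff n).contDiff
  constructor
  · rw [contDiff_iff_contDiffAt]
    rintro ⟨x, ξ⟩
    obtain ⟨j, hj⟩ := exists_eventually_gluedSymbol_eq he b x
    have hs : ContDiff ℝ ∞ fun p : E n × E n =>
        spatialCutoff n (p.1 - (10 * j : ℝ) • e) • b j p.2 := by
      have := hb j
      fun_prop
    refine hs.contDiffAt.congr_of_eventuallyEq ?_
    filter_upwards [continuousAt_fst.eventually hj] with p hp using hp p.2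
  · intro l k
    obtain ⟨C, hC0, hC⟩ := hbb k
    obtain ⟨D, hD⟩ := ((spatialCutoff n).hasCompactSupport.iteratedFDeriv
      (𝕜 := ℝ) l).exists_bound_of_continuous
      (hφ.continuous_iteratedFDeriv (by exact_mod_cast le_top))
    have hD0 : 0 ≤ D := (norm_nonneg _).trans (hD 0)
    refine ⟨D * C, fun x ξ => ?_⟩
    obtain ⟨j, hj⟩ := exists_eventually_gluedSymbol_eq he b x
    have h1 : (fun x' : E n => iteratedFDeriv ℝ k (fun ξ' => gluedSymbol e b x' ξ') ξ) =ᶠ[nhds x]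
        fun x' => spatialCutoff n (x' - (10 * j : ℝ) • e) • iteratedFDeriv ℝ k (b j) ξ := by
      filter_upwards [hj] with y hy
      rw [funext hy]
      exact iteratedFDeriv_const_smul_apply' ((hb j).contDiffAt.of_le (by exact_mod_cast le_top))
    rw [(Filter.EventuallyEq.iteratedFDeriv ℝ h1 l).eq_of_nhds]
    have h2 : ContDiff ℝ ∞ fun x' : E n => spatialCutoff n (x' - (10 * j : ℝ) • e) := by fun_prop
    rw [iteratedFDeriv_smul_const_apply (h2.contDiffAt.of_le (by exact_mod_cast le_top))]
    refine (ContinuousLinearMap.norm_compContinuousMultilinearMap_le _ _).trans ?_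
    rw [iteratedFDeriv_comp_sub]
    have h3 : ‖(ContinuousLinearMap.id ℝ ℝ).smulRight (iteratedFDeriv ℝ k (b j) ξ)‖ ≤
        C * (1 + ‖ξ‖) ^ (m - ρ * k) := by
      rw [ContinuousLinearMap.norm_smulRight_apply]
      refine (mul_le_of_le_one_left (norm_nonneg _) ContinuousLinearMap.norm_id_le).trans (hC j ξ)
    calc _ ≤ C * (1 + ‖ξ‖) ^ (m - ρ * k) * D := by gcongr; exact hD _
      _ = D * C * (1 + ‖ξ‖) ^ (m - ρ * k) := by ring
      -- Derivatives in `x` fall only on the fixed cutoffs and cost nothing; the allowed loss `δ l ≥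
      -- 0` is added for free.
      _ ≤ _ := by
        gcongr
        · linarith [norm_nonneg ξ]
        · have : 0 ≤ δ * l := by positivity
          linarith

/-! ### The pairing on the frequency side -/

lemma fourier_conj (g : E n → ℂ) (η : E n) :
    𝓕 (fun x => starRingEnd ℂ (g x)) (-η) = starRingEnd ℂ (𝓕 g η) := by
  rw [Real.fourier_eq, Real.fourier_eq, ← integral_conj]
  refine integral_congr_ae (Filter.Eventually.of_forall fun x => ?_)
  simp only [inner_neg_right, neg_neg, Circle.smul_def, smul_eq_mul, map_mul]
  rw [← Circle.coe_inv_eq_conj, ← AddChar.map_neg_eq_inv, neg_neg]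

lemma fourier_comp_neg (g : E n → ℂ) (η : E n) : 𝓕 (fun x => g (-x)) η = 𝓕 g (-η) := by
  rw [Real.fourier_eq, Real.fourier_eq, ← integral_neg_eq_self]
  simp

lemma integral_comp_inv_smul_eq {F : Type*} [NormedAddCommGroup F] [NormedSpace ℝ F]
    (f : E n → F) {s : ℝ} (hs : 0 < s) : ∫ x, f (s⁻¹ • x) = s ^ n • ∫ x, f x := by
  rw [Measure.integral_comp_inv_smul_of_nonneg _ _ hs.le, finrank_euclideanSpace_fin]

lemma fourier_comp_smul_sub (f : E n → ℂ) (c : E n) {s : ℝ} (hs : 0 < s) (η : E n) :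
    𝓕 (fun x => f (s • (x - c))) η =
      (s ^ n)⁻¹ • (Real.fourierChar (-inner ℝ c η) • 𝓕 f (s⁻¹ • η)) := by
  set F : E n → ℂ := fun y => (Real.fourierChar (-inner ℝ c η) : Circle) •
    (Real.fourierChar (-inner ℝ y (s⁻¹ • η)) • f y) with hF
  have h : ∀ x, Real.fourierChar (-inner ℝ (x + c) η) • f (s • (x + c - c)) = F (s • x) := by
    intro x
    have e : -inner ℝ (x + c) η = -inner ℝ c η + -inner ℝ (s • x) (s⁻¹ • η) := by
      rw [inner_add_left, real_inner_smul_left, real_inner_smul_right, mul_inv_cancel_left₀ hs.ne']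
      ring
    simp only [hF, add_sub_cancel_right, e, AddChar.map_add_eq_mul, Circle.smul_def, Circle.coe_mul,
      smul_eq_mul, mul_assoc]
  rw [Real.fourier_eq, Real.fourier_eq, ← integral_add_right_eq_self _ c]
  simp_rw [h]
  rw [Measure.integral_comp_smul_of_nonneg _ _ _ (hR := hs.le), finrank_euclideanSpace_fin]
  simp only [hF, Circle.smul_def]
  rw [integral_smul]

/-- The pairing of a Fourier multiplier, on the frequency side. -/
lemma pairing_pseudo_eq {a : E n → E n → ℂ} {b f g : E n → ℂ} (hb : Continuous b)
    (hbc : HasCompactSupport b) (hf : Integrable f) (hg : Integrable g)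
    (hab : ∀ x, g x ≠ 0 → ∀ ξ, a x ξ = b ξ) :
    pairing (pseudo a f) g =
      ∫ η, b ((2 * Real.pi) • η) * 𝓕 f η * starRingEnd ℂ (𝓕 g η) := by
  have hpi : (0 : ℝ) < 2 * Real.pi := by positivity
  set h : E n → ℂ := fun η => b ((2 * Real.pi) • η) * 𝓕 f η with hh
  have hFf : Continuous (𝓕 f) :=
    VectorFourier.fourierIntegral_continuous Real.continuous_fourierChar continuous_inner hf
  have hhc : Continuous h := by fun_prop
  have hhs : HasCompactSupport h :=
    (hbc.comp_smul (c := 2 * Real.pi) hpi.ne').mul_right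
  have hhi : Integrable h := hhc.integrable_of_hasCompactSupport hhs
  -- Only the values of `a` over points where `g` does not vanish enter the pairing. There `T_a f`
  -- is the inverse Fourier transform of `h`, the factor `(2π)^n` being used up by the change of
  -- variables.
  have h1 : ∀ x, g x ≠ 0 → pseudo a f x = 𝓕 (fun η => h (-η)) x := by
    intro x hx
    rw [fourier_comp_neg, Real.fourier_eq', pseudo]
    set F : E n → ℂ := fun η =>
      Complex.exp (((-2 * Real.pi * inner ℝ η (-x) : ℝ) : ℂ) * Complex.I) • h η with hF
    have e : ∀ ξ : E n, Complex.exp (Complex.I * ((inner ℝ x ξ : ℝ) : ℂ)) * a x ξ * fourier f ξ =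
        F ((2 * Real.pi)⁻¹ • ξ) := by
      intro ξ
      simp only [hF, hh, smul_smul, mul_inv_cancel₀ hpi.ne', one_smul, hab x hx, fourier, smul_eq_mul,
        mul_assoc, real_inner_smul_left, inner_neg_right]
      congr 2
      rw [mul_comm Complex.I, real_inner_comm]
      congr 2
      field_simp
    simp_rw [e]
    rw [integral_comp_inv_smul_eq _ hpi, Complex.real_smul, inv_mul_cancel_left₀]
    simp only [ne_eq, Complex.ofReal_eq_zero]
    positivity
  have h2 : pairing (pseudo a f) g =
      ∫ x, 𝓕 (fun η => h (-η)) x • starRingEnd ℂ (g x) := by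
    refine integral_congr_ae (Filter.Eventually.of_forall fun x => ?_)
    by_cases hx : g x = 0
    · simp [hx]
    · simp only [h1 x hx, smul_eq_mul]
  have hgc : Integrable fun x => starRingEnd ℂ (g x) :=
    (Complex.conjCLE : ℂ →L[ℝ] ℂ).integrable_comp hg
  -- The multiplication formula `∫ 𝓕h · k = ∫ h · 𝓕k` plays the role of Plancherel and asks only for
  -- integrability.
  have h3 := VectorFourier.integral_fourierIntegral_smul_eq_flip (L := innerₗ (E n))
    (μ := volume) (ν := volume) Real.continuous_fourierChar continuous_inner hhi.comp_neg hgc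
  rw [h2]
  refine h3.trans ?_
  rw [← integral_neg_eq_self]
  refine integral_congr_ae (Filter.Eventually.of_forall fun η => ?_)
  simp only [neg_neg, smul_eq_mul, hh]
  rw [flip_innerₗ]
  congr 1
  exact fourier_conj g η

/-! ### Dispersive decay of Fourier transforms of chirps -/

/-- The quadratic phase `exp(i Λ |y|²)`. -/
noncomputable def chirp (Λ : ℝ) (y : E n) : ℂ := Complex.exp (((Λ * ‖y‖ ^ 2 : ℝ) : ℂ) * Complex.I)

lemma norm_chirp (Λ : ℝ) (y : E n) : ‖chirp Λ y‖ = 1 := Complex.norm_exp_ofReal_mul_I _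

lemma contDiff_chirp (Λ : ℝ) : ContDiff ℝ ∞ (chirp (n := n) Λ) := by
  unfold chirp
  have : ContDiff ℝ ∞ fun y : E n => ‖y‖ ^ 2 := contDiff_norm_sq ℝ
  have h2 : ContDiff ℝ ∞ fun y : E n => ((Λ * ‖y‖ ^ 2 : ℝ) : ℂ) :=
    Complex.ofRealCLM.contDiff.comp (contDiff_const.mul this)
  exact (h2.mul contDiff_const).cexp

/-- A Gaussian with parameter `b = ε - iΛ` has an explicit transform: `(π / b)^{n/2}` times an
exponential with nonpositive real part. Since `Λ ≤ ‖b‖`, the bound survives the limit `ε → 0`, where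
the chirp itself is not integrable. -/
lemma norm_fourier_gaussian_le {Λ ε : ℝ} (hΛ : 0 < Λ) (hε : 0 < ε) (x w : E n) :
    ‖𝓕 (fun v : E n => Complex.exp (-((ε : ℂ) - Λ * Complex.I) * ‖v‖ ^ 2 +
      2 * Real.pi * Complex.I * inner ℝ x v)) w‖ ≤ (Real.pi / Λ) ^ ((n : ℝ) / 2) := by
  set b : ℂ := (ε : ℂ) - Λ * Complex.I with hb
  have hre : b.re = ε := by simp [hb]
  have him : b.im = -Λ := by simp [hb]
  have hb0 : b ≠ 0 := fun h => by rw [h] at hre; simp at hre; linarith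
  rw [fourier_gaussian_innerProductSpace' (by rw [hre]; exact hε), norm_mul]
  have h1 : ‖Complex.exp (-(Real.pi : ℂ) ^ 2 * ‖x - w‖ ^ 2 / b)‖ ≤ 1 := by
    rw [Complex.norm_exp]
    apply Real.exp_le_one_iff.2
    have e : (-(Real.pi : ℂ) ^ 2 * ‖x - w‖ ^ 2 / b) =
        ((-(Real.pi ^ 2 * ‖x - w‖ ^ 2) : ℝ) : ℂ) * b⁻¹ := by
      push_cast; ring
    rw [e, Complex.re_ofReal_mul, Complex.inv_re, hre]
    have : 0 ≤ ε / Complex.normSq b := div_nonneg hε.le (Complex.normSq_nonneg _)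
    nlinarith [mul_nonneg (mul_nonneg (sq_nonneg Real.pi) (sq_nonneg ‖x - w‖)) this]
  have h2 : ‖((Real.pi : ℂ) / b) ^ ((Module.finrank ℝ (E n) : ℂ) / 2)‖ ≤
      (Real.pi / Λ) ^ ((n : ℝ) / 2) := by
    have e : ((Module.finrank ℝ (E n) : ℂ) / 2) = (((n : ℝ) / 2 : ℝ) : ℂ) := by
      rw [finrank_euclideanSpace_fin]; push_cast; rfl
    rw [e, Complex.norm_cpow_real, norm_div, Complex.norm_real,
      Real.norm_of_nonneg Real.pi_pos.le]
    have hΛb : Λ ≤ ‖b‖ := by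
      have := Complex.abs_im_le_norm b
      rwa [him, abs_neg, abs_of_pos hΛ] at this
    gcongr
  calc _ ≤ (Real.pi / Λ) ^ ((n : ℝ) / 2) * 1 := by gcongr
    _ = _ := mul_one _

/-- Multiplication by a quadratic phase turns an integrable Fourier transform into a decaying
one. -/
lemma norm_fourier_chirp_smul_le {G : Type*} [NormedAddCommGroup G] [NormedSpace ℂ G]
    [CompleteSpace G] {F : E n → G} (hFc : Continuous F) (hF : Integrable F)
    (hF' : Integrable (𝓕 F)) {Λ : ℝ} (hΛ : 0 < Λ) (η : E n) :
    ‖𝓕 (fun y => chirp Λ y • F y) η‖ ≤ (Real.pi / Λ) ^ ((n : ℝ) / 2) * ∫ y, ‖𝓕 F y‖ := by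
  set u : ℝ → E n → ℂ := fun ε v => Complex.exp (-((ε : ℂ) - Λ * Complex.I) * ‖v‖ ^ 2 +
      2 * Real.pi * Complex.I * inner ℝ (-η) v) with hu
  have hinv : Integrable (𝓕⁻ F) := by
    have : 𝓕⁻ F = fun y => 𝓕 F (-y) := by ext y; exact Real.fourierInv_eq_fourier_neg F y
    rw [this]; exact hF'.comp_neg
  have hinvn : ∫ y, ‖𝓕⁻ F y‖ = ∫ y, ‖𝓕 F y‖ := by
    rw [← integral_neg_eq_self]
    refine integral_congr_ae (Filter.Eventually.of_forall fun y => ?_)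
    simp only [Real.fourierInv_eq_fourier_neg, neg_neg]
  -- Writing `F = 𝓕 (𝓕⁻ F)` moves the transform onto the damped chirp, which is estimated in the
  -- supremum norm, and leaves the `L¹` norm of `𝓕⁻ F`.
  have hbound : ∀ ε : ℝ, 0 < ε → ‖∫ y, u ε y • F y‖ ≤
      (Real.pi / Λ) ^ ((n : ℝ) / 2) * ∫ y, ‖𝓕 F y‖ := by
    intro ε hε
    have hui : Integrable (u ε) :=
      GaussianFourier.integrable_cexp_neg_mul_sq_norm_add (by simpa using hε) _ _
    have hflip := VectorFourier.integral_fourierIntegral_smul_eq_flip (L := innerₗ (E n))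
      (μ := volume) (ν := volume) Real.continuous_fourierChar continuous_inner hui hinv
    rw [flip_innerₗ] at hflip
    have h1 : ∫ y, u ε y • F y = ∫ y, 𝓕 (u ε) y • 𝓕⁻ F y := by
      refine Eq.trans ?_ hflip.symm
      refine integral_congr_ae (Filter.Eventually.of_forall fun y => ?_)
      have := congrFun (hFc.fourier_fourierInv_eq hF hF') y
      simp only
      congr 1
      exact this.symm
    rw [h1, ← hinvn, ← integral_const_mul]
    refine norm_integral_le_of_norm_le (hinv.norm.const_mul _)
      (Filter.Eventually.of_forall fun y => ?_)
    rw [norm_smul]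
    gcongr
    exact norm_fourier_gaussian_le hΛ hε _ _
  have hnorm : ∀ ε : ℝ, 0 ≤ ε → ∀ y, ‖u ε y‖ ≤ 1 := by
    intro ε hε y
    rw [hu, Complex.norm_exp]
    apply Real.exp_le_one_iff.2
    have e : (-((ε : ℂ) - Λ * Complex.I) * ‖y‖ ^ 2 +
      2 * Real.pi * Complex.I * inner ℝ (-η) y) = ((-(ε * ‖y‖ ^ 2) : ℝ) : ℂ) +
        ((Λ * ‖y‖ ^ 2 + 2 * Real.pi * inner ℝ (-η) y : ℝ) : ℂ) * Complex.I := by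
      push_cast; ring
    rw [e, Complex.add_re, Complex.ofReal_re, Complex.re_ofReal_mul, Complex.I_re]
    nlinarith [mul_nonneg hε (sq_nonneg ‖y‖)]
  -- The damping is removed by dominated convergence with majorant `‖F‖`.
  have hlim : Filter.Tendsto (fun ε : ℝ => ∫ y, u ε y • F y) (nhdsWithin 0 (Set.Ioi 0))
      (nhds (∫ y, u 0 y • F y)) := by
    refine tendsto_integral_filter_of_dominated_convergence (fun y => ‖F y‖) ?_ ?_ hF.norm ?_
    · refine Filter.Eventually.of_forall fun ε => ?_
      have : Continuous (u ε) := by rw [hu]; fun_prop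
      exact (this.smul hFc).aestronglyMeasurable
    · filter_upwards [self_mem_nhdsWithin] with ε hε
      refine Filter.Eventually.of_forall fun y => ?_
      rw [norm_smul]
      exact mul_le_of_le_one_left (norm_nonneg _) (hnorm ε (le_of_lt hε) y)
    · refine Filter.Eventually.of_forall fun y => ?_
      have : Continuous fun ε : ℝ => u ε y • F y := by rw [hu]; fun_prop
      exact (this.tendsto 0).mono_left nhdsWithin_le_nhds
  have h0 : 𝓕 (fun y => chirp Λ y • F y) η = ∫ y, u 0 y • F y := by
    rw [Real.fourier_eq']
    refine integral_congr_ae (Filter.Eventually.of_forall fun y => ?_)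
    simp only [hu, smul_smul, chirp, ← Complex.exp_add]
    congr 2
    rw [inner_neg_left, real_inner_comm]
    push_cast
    ring
  rw [h0]
  exact le_of_tendsto hlim.norm (Filter.eventually_of_mem self_mem_nhdsWithin fun ε hε => hbound ε hε)

/-- Derivatives of the transform bring down powers of the variable, and the chirp factors out of
them. The vector-valued decay estimate then applies to a function `F` independent of `Λ`. -/
lemma fourierPowSMulRight_mul (f g : E n → ℂ) (v : E n) (k : ℕ) :
    VectorFourier.fourierPowSMulRight (innerSL ℝ) (fun y => f y * g y) v k =
      f v • VectorFourier.fourierPowSMulRight (innerSL ℝ) g v k := by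
  ext m
  simp only [VectorFourier.fourierPowSMulRight_apply, smul_apply,
    smul_eq_mul, Complex.real_smul]
  ring

lemma integrable_norm_pow_mul {f : E n → ℂ} (hf : Continuous f) (hc : HasCompactSupport f)
    (k : ℕ) : Integrable fun v => ‖v‖ ^ k * ‖f v‖ := by
  refine Continuous.integrable_of_hasCompactSupport (by fun_prop) ?_
  exact (hc.norm).mul_left

lemma contDiff_fourier_of_hasCompactSupport {f : E n → ℂ} (hf : Continuous f)
    (hc : HasCompactSupport f) : ContDiff ℝ ∞ (𝓕 f) :=
  Real.contDiff_fourier (N := ⊤) fun k _ => integrable_norm_pow_mul hf hc k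

/-- Uniform bounds for the derivatives of the Fourier transform of a chirped bump. -/
lemma exists_norm_iteratedFDeriv_fourier_chirp_le {ψ : E n → ℂ} (hψ : ContDiff ℝ ∞ ψ)
    (hc : HasCompactSupport ψ) (k : ℕ) :
    ∃ C : ℝ, ∀ Λ : ℝ, 0 < Λ → ∀ η : E n,
      ‖iteratedFDeriv ℝ k (𝓕 (fun y => chirp Λ y * ψ y)) η‖ ≤ C * Λ ^ (-((n : ℝ) / 2)) := by
  set F := fun v : E n => VectorFourier.fourierPowSMulRight (innerSL ℝ) ψ v k with hFdef
  have hFeq : 𝓕 F = iteratedFDeriv ℝ k (𝓕 ψ) :=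
    (Real.iteratedFDeriv_fourier (N := ⊤) (fun j _ => integrable_norm_pow_mul hψ.continuous hc j)
      hψ.continuous.aestronglyMeasurable le_top).symm
  have hFc : Continuous F := hψ.continuous.fourierPowSMulRight _ k
  have hF : Integrable F :=
    VectorFourier.integrable_fourierPowSMulRight _ (integrable_norm_pow_mul hψ.continuous hc k)
      hψ.continuous.aestronglyMeasurable
  have hF' : Integrable (𝓕 F) := by
    rw [hFeq]
    have h := (𝓕 (hc.toSchwartzMap hψ)).integrable_pow_mul_iteratedFDeriv volume 0 k
    simp only [pow_zero, one_mul] at h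
    rw [← integrable_norm_iff]
    · exact h
    · exact ((contDiff_fourier_of_hasCompactSupport hψ.continuous hc).continuous_iteratedFDeriv
        (by exact_mod_cast le_top)).aestronglyMeasurable
  refine ⟨Real.pi ^ ((n : ℝ) / 2) * ∫ y, ‖𝓕 F y‖, fun Λ hΛ η => ?_⟩
  have hcc : Continuous fun y : E n => chirp Λ y * ψ y :=
    (contDiff_chirp Λ).continuous.mul hψ.continuous
  have hcs : HasCompactSupport fun y : E n => chirp Λ y * ψ y := hc.mul_left
  rw [Real.iteratedFDeriv_fourier (N := ⊤) (fun j _ => integrable_norm_pow_mul hcc hcs j)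
      hcc.aestronglyMeasurable le_top]
  simp_rw [fourierPowSMulRight_mul]
  refine (norm_fourier_chirp_smul_le hFc hF hF' hΛ η).trans_eq ?_
  rw [Real.div_rpow Real.pi_pos.le hΛ.le, Real.rpow_neg hΛ.le]
  ring

/-! ### Frequency localization of the chirped bump -/

/-- A standard real bump supported in the unit ball. -/
noncomputable def unitBump (n : ℕ) : ContDiffBump (0 : E n) where
  rIn := 1 / 2
  rOut := 1
  rIn_pos := by norm_num
  rIn_lt_rOut := by norm_num

/-- The standard bump as a complex-valued function. -/
noncomputable def bump (x : E n) : ℂ := ((unitBump n x : ℝ) : ℂ)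

/-- A bump carrying a quadratic phase. -/
noncomputable def chirpBump (Λ : ℝ) (y : E n) : ℂ := chirp Λ y * bump y

lemma contDiff_bump : ContDiff ℝ ∞ (bump (n := n)) :=
  Complex.ofRealCLM.contDiff.comp (unitBump n).contDiff

lemma hasCompactSupport_bump : HasCompactSupport (bump (n := n)) :=
  (unitBump n).hasCompactSupport.comp_left (g := ((↑) : ℝ → ℂ)) Complex.ofReal_zero

lemma norm_bump (x : E n) : ‖bump x‖ = unitBump n x := by
  rw [bump, Complex.norm_real, Real.norm_of_nonneg (unitBump n).nonneg]

lemma norm_bump_le_one (x : E n) : ‖bump x‖ ≤ 1 := by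
  rw [norm_bump]; exact (unitBump n).le_one

lemma bump_eq_zero {x : E n} (hx : 1 ≤ ‖x‖) : bump x = 0 := by
  rw [bump, (unitBump n).zero_of_le_dist (by rw [dist_zero_right]; exact hx), Complex.ofReal_zero]

lemma bump_neg (x : E n) : bump (-x) = bump x := by
  rw [bump, ContDiffBump.neg, bump]

lemma contDiff_chirpBump (Λ : ℝ) : ContDiff ℝ ∞ (chirpBump (n := n) Λ) :=
  (contDiff_chirp Λ).mul contDiff_bump

lemma hasCompactSupport_chirpBump (Λ : ℝ) : HasCompactSupport (chirpBump (n := n) Λ) :=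
  hasCompactSupport_bump.mul_left

lemma norm_chirpBump (Λ : ℝ) (x : E n) : ‖chirpBump Λ x‖ = ‖bump x‖ := by
  rw [chirpBump, norm_mul, norm_chirp, one_mul]

lemma chirpBump_neg (Λ : ℝ) (x : E n) : chirpBump Λ (-x) = chirpBump Λ x := by
  rw [chirpBump, chirpBump, bump_neg, chirp, chirp, norm_neg]

lemma integral_norm_bump_sq_pos : 0 < ∫ x : E n, ‖bump x‖ ^ 2 := by
  have hc : Continuous fun x : E n => ‖bump x‖ ^ 2 :=
    (contDiff_bump.continuous.norm).pow 2
  refine hc.integral_pos_of_hasCompactSupport_nonneg_nonzero (x := 0) ?_ (fun x => by positivity) ?_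
  · exact (hasCompactSupport_bump.norm).comp_left (g := fun t : ℝ => t ^ 2) (by simp)
  · rw [norm_bump, (unitBump n).one_of_mem_closedBall (by simp [unitBump])]
    norm_num

lemma integral_norm_fourier_sq {f : E n → ℂ} (hf : ContDiff ℝ ∞ f) (hc : HasCompactSupport f) :
    ∫ ζ, ‖𝓕 f ζ‖ ^ 2 = ∫ x, ‖f x‖ ^ 2 :=
  SchwartzMap.integral_norm_sq_fourier (hc.toSchwartzMap hf)

lemma integrable_norm_fourier_sq {f : E n → ℂ} (hf : ContDiff ℝ ∞ f) (hc : HasCompactSupport f) :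
    Integrable fun ζ => ‖𝓕 f ζ‖ ^ 2 :=
  ((𝓕 (hc.toSchwartzMap hf)).memLp 2 volume).integrable_norm_pow two_ne_zero

lemma fourier_fderiv_apply {f : E n → ℂ} (hf : ContDiff ℝ ∞ f) (hc : HasCompactSupport f)
    (v ζ : E n) : 𝓕 (fun x => fderiv ℝ f x v) ζ =
      2 * Real.pi * Complex.I * (inner ℝ v ζ : ℝ) * 𝓕 f ζ := by
  have hfd : Continuous (fderiv ℝ f) := hf.continuous_fderiv (by simp)
  have hi : Integrable f := hf.continuous.integrable_of_hasCompactSupport hc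
  have hi' : Integrable (fderiv ℝ f) := hfd.integrable_of_hasCompactSupport (hc.fderiv ℝ)
  rw [← Real.fourier_continuousLinearMap_apply hi',
    Real.fourier_fderiv hi (hf.differentiable (by simp)) hi']
  simp only [VectorFourier.fourierSMulRight_apply, neg_apply, neg_smul,
    smul_eq_mul, Complex.real_smul]
  rw [show (innerSL ℝ ζ) v = inner ℝ v ζ from by rw [innerSL_apply_apply, real_inner_comm]]
  ring

/-- Plancherel for each partial derivative. It expresses the second moment of `|𝓕 f|²`, needed for a
Chebyshev-type argument, through the gradient of `f`. -/
lemma integrable_norm_sq_mul_fourier_sq {f : E n → ℂ} (hf : ContDiff ℝ ∞ f)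
    (hc : HasCompactSupport f) : Integrable (fun ζ => ‖ζ‖ ^ 2 * ‖𝓕 f ζ‖ ^ 2) ∧
    (2 * Real.pi) ^ 2 * ∫ ζ, ‖ζ‖ ^ 2 * ‖𝓕 f ζ‖ ^ 2 =
      ∑ i : Fin n, ∫ x, ‖fderiv ℝ f x (EuclideanSpace.single i 1)‖ ^ 2 := by
  have hs : ∀ v : E n, ContDiff ℝ ∞ fun x => fderiv ℝ f x v := fun v =>
    (hf.fderiv_right (m := ∞) (by simp)).clm_apply contDiff_const
  have hcs : ∀ v : E n, HasCompactSupport fun x => fderiv ℝ f x v := fun v =>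
    hc.fderiv_apply ℝ v
  have e : ∀ ζ : E n, (2 * Real.pi) ^ 2 * (‖ζ‖ ^ 2 * ‖𝓕 f ζ‖ ^ 2) =
      ∑ i : Fin n, ‖𝓕 (fun x => fderiv ℝ f x (EuclideanSpace.single i 1)) ζ‖ ^ 2 := by
    intro ζ
    simp_rw [fourier_fderiv_apply hf hc, EuclideanSpace.norm_sq_eq ζ]
    simp only [norm_mul, mul_pow, EuclideanSpace.inner_single_left, map_one, one_mul,
      Complex.norm_real, Complex.norm_I, mul_one, Complex.norm_ofNat]
    rw [← Finset.sum_mul, ← Finset.mul_sum, Real.norm_of_nonneg Real.pi_pos.le]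
    ring
  have hi : ∀ i : Fin n, Integrable fun ζ =>
      ‖𝓕 (fun x => fderiv ℝ f x (EuclideanSpace.single i 1)) ζ‖ ^ 2 :=
    fun i => integrable_norm_fourier_sq (hs _) (hcs _)
  constructor
  · have h := (integrable_finsetSum Finset.univ fun i _ => hi i).const_mul ((2 * Real.pi) ^ 2)⁻¹
    refine h.congr (Filter.Eventually.of_forall fun ζ => ?_)
    simp only
    rw [← e ζ, inv_mul_cancel_left₀ (by positivity)]
  · rw [← integral_const_mul]
    simp_rw [e]
    rw [integral_finsetSum _ fun i _ => hi i]
    exact Finset.sum_congr rfl fun i _ => integral_norm_fourier_sq (hs _) (hcs _)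

/-- Differentiating the phase produces `2iΛ⟨x, v⟩`, of modulus at most `2Λ` on the unit ball; the
constants 8 and 2 come from `(s + t)² ≤ 2s² + 2t²`. -/
lemma norm_fderiv_chirpBump_sq_le {Λ : ℝ} (hΛ : 0 ≤ Λ) (x v : E n) (hv : ‖v‖ = 1) :
    ‖fderiv ℝ (chirpBump Λ) x v‖ ^ 2 ≤
      8 * Λ ^ 2 * ‖bump x‖ ^ 2 + 2 * ‖fderiv ℝ (bump (n := n)) x v‖ ^ 2 := by
  have h1 : HasFDerivAt (fun y : E n => ((Λ * ‖y‖ ^ 2 : ℝ) : ℂ) * Complex.I)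
      ((Complex.ofRealCLM.comp (Λ • (2 • innerSL ℝ x))).smulRight Complex.I) x := by
    have h := ((hasStrictFDerivAt_norm_sq x).hasFDerivAt.const_mul Λ)
    exact (Complex.ofRealCLM.hasFDerivAt.comp x h).mul_const' Complex.I
  have h2 := h1.cexp
  have h3 : HasFDerivAt (bump (n := n)) (fderiv ℝ bump x) x :=
    (contDiff_bump.differentiable (by simp) x).hasFDerivAt
  have h4 := h2.mul h3
  have h5 : fderiv ℝ (chirpBump Λ) x v = chirp Λ x * (fderiv ℝ bump x v +
      ((Λ * (2 * inner ℝ x v) : ℝ) : ℂ) * Complex.I * bump x) := by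
    have : HasFDerivAt (chirpBump Λ) _ x := h4
    rw [this.fderiv]
    simp [chirp]
    ring
  rw [h5, norm_mul, norm_chirp, one_mul]
  set A := ‖fderiv ℝ (bump (n := n)) x v‖
  have h6 : ‖((Λ * (2 * inner ℝ x v) : ℝ) : ℂ) * Complex.I * bump x‖ ≤ 2 * Λ * ‖bump x‖ := by
    by_cases hx : 1 ≤ ‖x‖
    · simp [bump_eq_zero hx]
    · push Not at hx
      rw [norm_mul, norm_mul, Complex.norm_I, mul_one, Complex.norm_real, norm_mul, norm_mul,
        Real.norm_of_nonneg hΛ, Real.norm_of_nonneg zero_le_two]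
      have : ‖(inner ℝ x v : ℝ)‖ ≤ 1 := by
        calc _ ≤ ‖x‖ * ‖v‖ := norm_inner_le_norm x v
          _ ≤ 1 := by rw [hv, mul_one]; exact hx.le
      refine mul_le_mul_of_nonneg_right ?_ (norm_nonneg _)
      nlinarith
  have h7 := (norm_add_le (fderiv ℝ bump x v)
    (((Λ * (2 * inner ℝ x v) : ℝ) : ℂ) * Complex.I * bump x)).trans (add_le_add_right h6 A)
  calc _ ≤ (A + 2 * Λ * ‖bump x‖) ^ 2 := pow_le_pow_left₀ (norm_nonneg _) h7 2
    _ ≤ _ := by nlinarith [sq_nonneg (A - 2 * Λ * ‖bump x‖)]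

/-- A frequency cutoff adapted to the Fourier transform of the bump. -/
lemma exists_frequency_cutoff (n : ℕ) : ∃ φ : E n → ℝ, ContDiff ℝ ∞ φ ∧ HasCompactSupport φ ∧
    (∃ c r : ℝ, 0 < c ∧ 0 < r ∧
      ∀ η, c * (1 - ‖η‖ ^ 2 / r ^ 2) ≤ ((φ η : ℂ) * 𝓕 (bump (n := n)) η).re) ∧
    0 < ∫ η, φ η * ‖𝓕 (bump (n := n)) η‖ ^ 2 := by
  have hcont : Continuous (𝓕 (bump (n := n))) :=
    (contDiff_fourier_of_hasCompactSupport contDiff_bump.continuous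
      hasCompactSupport_bump).continuous
  have h0 : 𝓕 (bump (n := n)) 0 = ((∫ x, unitBump n x : ℝ) : ℂ) := by
    rw [Real.fourier_eq]
    simp only [inner_zero_right, neg_zero, AddChar.map_zero_eq_one, one_smul, bump]
    exact integral_ofReal
  set c0 : ℝ := ∫ x, unitBump n x with hc0
  have hc0' : 0 < c0 := (unitBump n).integral_pos
  have hnear : ∀ᶠ η in nhds (0 : E n), c0 / 2 < (𝓕 (bump (n := n)) η).re := by
    refine (Complex.continuous_re.comp hcont).continuousAt.eventually_const_lt ?_
    rw [Function.comp_apply, h0, Complex.ofReal_re]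
    linarith
  obtain ⟨d, hd, hball⟩ := Metric.eventually_nhds_iff.1 hnear
  let φ : ContDiffBump (0 : E n) :=
    { rIn := d / 2, rOut := d, rIn_pos := by linarith, rIn_lt_rOut := by linarith }
  refine ⟨φ, φ.contDiff, φ.hasCompactSupport, ⟨c0 / 2, d / 2, by linarith, by linarith, ?_⟩, ?_⟩
  -- The quadratic minorant is at most `c` where the cutoff is 1 and nonpositive beyond. Integrated
  -- against `|𝓕 chirp|²`, it involves only the zeroth and second moments.
  · intro η
    rw [Complex.re_ofReal_mul]
    by_cases h1 : ‖η‖ ≤ d / 2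
    · rw [φ.one_of_mem_closedBall (mem_closedBall_zero_iff.2 h1), one_mul]
      have h2 := hball (y := η) (by rw [dist_zero_right]; linarith)
      have h3 : 0 ≤ ‖η‖ ^ 2 / (d / 2) ^ 2 := by positivity
      nlinarith
    · push Not at h1
      have h3 : 1 ≤ ‖η‖ ^ 2 / (d / 2) ^ 2 := by
        rw [one_le_div (by positivity)]
        gcongr
      have h4 : 0 ≤ φ η * (𝓕 (bump (n := n)) η).re := by
        by_cases h5 : ‖η‖ < d
        · have h2 := hball (y := η) (by rw [dist_zero_right]; exact h5)
          exact mul_nonneg φ.nonneg (by linarith)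
        · rw [φ.zero_of_le_dist (by rw [dist_zero_right]; exact not_lt.1 h5), zero_mul]
      nlinarith
  · have hc : Continuous fun η => φ η * ‖𝓕 (bump (n := n)) η‖ ^ 2 :=
      φ.continuous.mul (hcont.norm.pow 2)
    refine hc.integral_pos_of_hasCompactSupport_nonneg_nonzero (x := 0)
      φ.hasCompactSupport.mul_right (fun x => mul_nonneg φ.nonneg (by positivity)) ?_
    rw [φ.one_of_mem_closedBall (by simp [φ.rIn_pos.le]), one_mul, h0, Complex.norm_real]
    have : ‖c0‖ ≠ 0 := norm_ne_zero_iff.2 hc0'.ne'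
    positivity

lemma integrable_norm_sq_of_hasCompactSupport {f : E n → ℂ} (hf : Continuous f)
    (hc : HasCompactSupport f) : Integrable fun x => ‖f x‖ ^ 2 :=
  (hf.memLp_of_hasCompactSupport (p := 2) hc).integrable_norm_pow two_ne_zero

lemma integrable_norm_fderiv_sq {f : E n → ℂ} (hf : ContDiff ℝ ∞ f) (hfc : HasCompactSupport f)
    (v : E n) : Integrable fun x => ‖fderiv ℝ f x v‖ ^ 2 := by
  have h1 : Continuous fun x => fderiv ℝ f x v :=
    (hf.continuous_fderiv (by simp)).clm_apply continuous_const
  exact integrable_norm_sq_of_hasCompactSupport h1 (hfc.fderiv_apply ℝ v)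

lemma sum_integral_norm_fderiv_chirpBump_sq_le {Λ : ℝ} (hΛ : 0 ≤ Λ) :
    ∑ i : Fin n, ∫ x, ‖fderiv ℝ (chirpBump (n := n) Λ) x (EuclideanSpace.single i 1)‖ ^ 2 ≤
      n * (8 * Λ ^ 2 * ∫ x : E n, ‖bump x‖ ^ 2) +
        2 * ∑ i : Fin n, ∫ x, ‖fderiv ℝ (bump (n := n)) x (EuclideanSpace.single i 1)‖ ^ 2 := by
  have hib : Integrable fun x : E n => ‖bump x‖ ^ 2 :=
    integrable_norm_sq_of_hasCompactSupport contDiff_bump.continuous hasCompactSupport_bump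
  have h : ∀ i : Fin n,
      ∫ x, ‖fderiv ℝ (chirpBump (n := n) Λ) x (EuclideanSpace.single i 1)‖ ^ 2 ≤
      8 * Λ ^ 2 * (∫ x : E n, ‖bump x‖ ^ 2) +
        2 * ∫ x, ‖fderiv ℝ (bump (n := n)) x (EuclideanSpace.single i 1)‖ ^ 2 := by
    intro i
    have hb := integrable_norm_fderiv_sq contDiff_bump hasCompactSupport_bump
      (EuclideanSpace.single i (1 : ℝ))
    have hγ := integrable_norm_fderiv_sq (contDiff_chirpBump Λ) (hasCompactSupport_chirpBump Λ)
      (EuclideanSpace.single i (1 : ℝ))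
    rw [← integral_const_mul, ← integral_const_mul,
      ← integral_add (hib.const_mul _) (hb.const_mul _)]
    exact integral_mono hγ ((hib.const_mul _).add (hb.const_mul _)) fun x =>
      norm_fderiv_chirpBump_sq_le hΛ x _ (by simp)
  refine (Finset.sum_le_sum fun i _ => h i).trans_eq ?_
  rw [Finset.sum_add_distrib, Finset.sum_const, Finset.card_univ, Fintype.card_fin, nsmul_eq_mul,
    ← Finset.mul_sum]

/-- Most of the `L²` mass of the Fourier transform of a chirped bump lies at frequencies
below the chirp rate. -/
lemma exists_le_norm_integral_chirpBump (hn : 0 < n) {φ : E n → ℝ} (hφ : ContDiff ℝ ∞ φ)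
    (hφc : HasCompactSupport φ) {c r : ℝ} (hc : 0 < c) (hr : 0 < r)
    (hφr : ∀ η, c * (1 - ‖η‖ ^ 2 / r ^ 2) ≤ ((φ η : ℂ) * 𝓕 (bump (n := n)) η).re) :
    ∃ ε c' N₀ : ℝ, 0 < ε ∧ 0 < c' ∧ ∀ N : ℝ, N₀ ≤ N → 1 ≤ N →
      c' ≤ ‖∫ ζ : E n, (φ (N⁻¹ • ζ) : ℂ) * 𝓕 (bump (n := n)) (N⁻¹ • ζ) *
        ((‖𝓕 (chirpBump (n := n) (ε * N)) ζ‖ ^ 2 : ℝ) : ℂ)‖ := by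
  have hn' : (0 : ℝ) < n := by exact_mod_cast hn
  set A : ℝ := ∫ x : E n, ‖bump x‖ ^ 2 with hA
  have hA0 : 0 < A := integral_norm_bump_sq_pos
  set D : ℝ := ∑ i : Fin n, ∫ x : E n, ‖fderiv ℝ (bump (n := n)) x (EuclideanSpace.single i 1)‖ ^ 2
    with hD
  have hD0 : 0 ≤ D := Finset.sum_nonneg fun i _ => integral_nonneg fun x => by positivity
  -- The factor `1/√n` cancels the `n` from summing over coordinates, so the gradient energy is at
  -- most `8 r² N² A + 2D`; for `N ≥ N₀`, `D ≤ A r² N²`. Since `(2π)² ≥ 36`, the lost proportion is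
  -- at most `10/36`, leaving more than the claimed quarter.
  refine ⟨r / √n, c * A / 4, 1 + D / (A * r ^ 2), by positivity, by positivity, fun N hN hN1 => ?_⟩
  have hN0 : 0 < N := by linarith
  set Λ : ℝ := r / √n * N with hΛ
  have hΛ0 : 0 ≤ Λ := by positivity
  have hs := contDiff_chirpBump (n := n) Λ
  have hcs := hasCompactSupport_chirpBump (n := n) Λ
  obtain ⟨hi2, he2⟩ := integrable_norm_sq_mul_fourier_sq hs hcs
  have hi1 := integrable_norm_fourier_sq hs hcs
  have he1 : ∫ ζ, ‖𝓕 (chirpBump (n := n) Λ) ζ‖ ^ 2 = A := by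
    rw [integral_norm_fourier_sq hs hcs]
    simp_rw [norm_chirpBump]
    exact hA.symm
  have hgrad : (2 * Real.pi) ^ 2 * ∫ ζ, ‖ζ‖ ^ 2 * ‖𝓕 (chirpBump (n := n) Λ) ζ‖ ^ 2 ≤
      8 * (r ^ 2 * N ^ 2) * A + 2 * D := by
    rw [he2]
    refine (sum_integral_norm_fderiv_chirpBump_sq_le hΛ0).trans_eq ?_
    rw [← hA, ← hD, hΛ, mul_pow, div_pow, Real.sq_sqrt hn'.le]
    field_simp
  have hFcont : ∀ {f : E n → ℂ}, Continuous f → HasCompactSupport f → Continuous (𝓕 f) :=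
    fun hf hfc => (contDiff_fourier_of_hasCompactSupport hf hfc).continuous
  have hint : Integrable fun ζ : E n => (φ (N⁻¹ • ζ) : ℂ) * 𝓕 (bump (n := n)) (N⁻¹ • ζ) *
        ((‖𝓕 (chirpBump (n := n) Λ) ζ‖ ^ 2 : ℝ) : ℂ) := by
    have h1 := hFcont contDiff_bump.continuous (hasCompactSupport_bump (n := n))
    have h2 := hFcont hs.continuous hcs
    have h3 := hφ.continuous
    refine Continuous.integrable_of_hasCompactSupport (by fun_prop) ?_
    have h4 : HasCompactSupport fun ζ : E n => (φ (N⁻¹ • ζ) : ℂ) :=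
      (hφc.comp_smul (inv_ne_zero hN0.ne')).comp_left (g := ((↑) : ℝ → ℂ)) Complex.ofReal_zero
    exact h4.mul_right.mul_right
  refine le_trans ?_ (Complex.re_le_norm _)
  have hre := (Complex.reCLM.integral_comp_comm hint).symm
  simp only [Complex.reCLM_apply] at hre
  rw [hre]
  set I2 := ∫ ζ, ‖ζ‖ ^ 2 * ‖𝓕 (chirpBump (n := n) Λ) ζ‖ ^ 2 with hI2
  have hlow : c * (A - (N ^ 2 * r ^ 2)⁻¹ * I2) ≤
      ∫ ζ : E n, ((φ (N⁻¹ • ζ) : ℂ) * 𝓕 (bump (n := n)) (N⁻¹ • ζ) *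
        ((‖𝓕 (chirpBump (n := n) Λ) ζ‖ ^ 2 : ℝ) : ℂ)).re := by
    rw [← he1, hI2, ← integral_const_mul, ← integral_sub hi1 (hi2.const_mul _),
      ← integral_const_mul]
    refine integral_mono ((hi1.sub (hi2.const_mul _)).const_mul c) hint.re fun ζ => ?_
    simp only
    rw [mul_comm (_ * _) (((_ : ℝ)) : ℂ), Complex.re_ofReal_mul]
    have h := hφr (N⁻¹ • ζ)
    rw [norm_inv_smul hN0] at h
    calc _ = ‖𝓕 (chirpBump (n := n) Λ) ζ‖ ^ 2 * (c * (1 - (‖ζ‖ / N) ^ 2 / r ^ 2)) := by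
          field_simp
      _ ≤ _ := by gcongr
  refine le_trans ?_ hlow
  have hNA : D ≤ A * (N ^ 2 * r ^ 2) := by
    have h1 : D / (A * r ^ 2) ≤ N := by linarith
    rw [div_le_iff₀ (by positivity)] at h1
    have h2 : N ≤ N ^ 2 := by nlinarith
    calc D ≤ N * (A * r ^ 2) := h1
      _ ≤ N ^ 2 * (A * r ^ 2) := by gcongr
      _ = _ := by ring
  have hpi : (36 : ℝ) ≤ (2 * Real.pi) ^ 2 := by nlinarith [Real.pi_gt_three]
  have hI20 : 0 ≤ I2 := integral_nonneg fun ζ => by positivity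
  have h36 : 36 * I2 ≤ 10 * A * (N ^ 2 * r ^ 2) := by nlinarith
  have h5 : (N ^ 2 * r ^ 2)⁻¹ * I2 ≤ 10 / 36 * A := by
    rw [inv_mul_le_iff₀ (by positivity)]
    linarith
  nlinarith

/-! ### The two profiles and their derivative bounds -/

/-- The plane wave `η ↦ exp(i e·η)`. -/
noncomputable def planeWave (e η : E n) : ℂ := Complex.exp (((inner ℝ e η : ℝ) : ℂ) * Complex.I)

/-- The normalized Fourier transform of a chirped bump. -/
noncomputable def chirpProfile (Λ : ℝ) (η : E n) : ℂ :=
  Λ ^ ((n : ℝ) / 2) • 𝓕 (chirpBump (n := n) Λ) ((2 * Real.pi)⁻¹ • η)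

lemma contDiff_planeWave (e : E n) : ContDiff ℝ ∞ (planeWave e) := by
  have h : ContDiff ℝ ∞ fun η : E n => ((inner ℝ e η : ℝ) : ℂ) :=
    Complex.ofRealCLM.contDiff.comp (innerSL ℝ e).contDiff
  exact (h.mul contDiff_const).cexp

lemma iteratedDeriv_cexp_mul_I (k : ℕ) :
    iteratedDeriv k (fun t : ℝ => Complex.exp ((t : ℂ) * Complex.I)) =
      fun t : ℝ => Complex.I ^ k * Complex.exp ((t : ℂ) * Complex.I) := by
  induction k with
  | zero => simp
  | succ k ih =>
    rw [iteratedDeriv_succ, ih]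
    ext t
    have h : HasDerivAt (fun t : ℝ => (t : ℂ) * Complex.I) Complex.I t := by
      simpa using (Complex.ofRealCLM.hasDerivAt (x := t)).mul_const Complex.I
    rw [(h.cexp.const_mul (Complex.I ^ k)).deriv]
    ring

lemma norm_iteratedFDeriv_planeWave_le (e : E n) (k : ℕ) (η : E n) :
    ‖iteratedFDeriv ℝ k (planeWave e) η‖ ≤ ‖e‖ ^ k := by
  have hs : ContDiff ℝ ∞ fun t : ℝ => Complex.exp ((t : ℂ) * Complex.I) :=
    (Complex.ofRealCLM.contDiff.mul contDiff_const).cexp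
  have h : planeWave e = (fun t : ℝ => Complex.exp ((t : ℂ) * Complex.I)) ∘ (innerSL ℝ e) := rfl
  rw [h, (innerSL ℝ e).iteratedFDeriv_comp_right hs η (by exact_mod_cast le_top)]
  refine (ContinuousMultilinearMap.norm_compContinuousLinearMap_le _ _).trans ?_
  rw [norm_iteratedFDeriv_eq_norm_iteratedDeriv, iteratedDeriv_cexp_mul_I]
  simp [Complex.norm_exp_ofReal_mul_I]

lemma contDiff_fourier_chirpBump (Λ : ℝ) : ContDiff ℝ ∞ (𝓕 (chirpBump (n := n) Λ)) :=
  contDiff_fourier_of_hasCompactSupport (contDiff_chirpBump Λ).continuous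
    (hasCompactSupport_chirpBump Λ)

lemma contDiff_chirpProfile (Λ : ℝ) : ContDiff ℝ ∞ (chirpProfile (n := n) Λ) := by
  have := contDiff_fourier_chirpBump (n := n) Λ
  unfold chirpProfile
  fun_prop

lemma chirpProfile_two_pi (Λ : ℝ) (η : E n) : chirpProfile Λ ((2 * Real.pi) • η) =
    ((Λ ^ ((n : ℝ) / 2) : ℝ) : ℂ) * 𝓕 (chirpBump (n := n) Λ) η := by
  rw [chirpProfile, inv_smul_smul₀ (by positivity), Complex.real_smul]

/-- The normalization `Λ^{n/2}` exactly cancels the dispersive decay, at every order of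
differentiation. -/
lemma exists_norm_iteratedFDeriv_chirpProfile_le (n k : ℕ) :
    ∃ C : ℝ, ∀ Λ : ℝ, 0 < Λ → ∀ η : E n, ‖iteratedFDeriv ℝ k (chirpProfile Λ) η‖ ≤ C := by
  obtain ⟨C, hC⟩ := exists_norm_iteratedFDeriv_fourier_chirp_le (n := n) contDiff_bump
    hasCompactSupport_bump k
  refine ⟨C, fun Λ hΛ η => ?_⟩
  have hs := contDiff_fourier_chirpBump (n := n) Λ
  have hs' : ContDiff ℝ ∞ fun η : E n => 𝓕 (chirpBump (n := n) Λ) ((2 * Real.pi)⁻¹ • η) := by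
    fun_prop
  have e : chirpProfile (n := n) Λ = fun η => Λ ^ ((n : ℝ) / 2) •
      𝓕 (chirpBump (n := n) Λ) ((2 * Real.pi)⁻¹ • η) := rfl
  rw [e, iteratedFDeriv_const_smul_apply' (hs'.contDiffAt.of_le (by exact_mod_cast le_top)),
    norm_smul, norm_iteratedFDeriv_comp_smul hs (by positivity), Real.norm_of_nonneg (by positivity)]
  have hpi : ((2 * Real.pi)⁻¹) ^ k ≤ 1 :=
    pow_le_one₀ (by positivity) (inv_le_one_of_one_le₀ (by nlinarith [Real.pi_gt_three]))
  calc _ ≤ Λ ^ ((n : ℝ) / 2) * (1 * (C * Λ ^ (-((n : ℝ) / 2)))) := by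
        gcongr
        exact hC Λ hΛ _
    _ = C * (Λ ^ ((n : ℝ) / 2) * Λ ^ (-((n : ℝ) / 2))) := by ring
    _ = C := by rw [← Real.rpow_add hΛ, add_neg_cancel, Real.rpow_zero, mul_one]

/-! ### Evaluating the blocks on test functions -/

/-- The function `F` rescaled to the ball of radius `s⁻¹` around `c`. -/
def rescale (F : E n → ℂ) (s : ℝ) (c x : E n) : ℂ := F (s • (x - c))

lemma contDiff_rescale {F : E n → ℂ} (hF : ContDiff ℝ ∞ F) (s : ℝ) (c : E n) :
    ContDiff ℝ ∞ (rescale F s c) := by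
  unfold rescale
  fun_prop

lemma rescale_eq_zero {F : E n → ℂ} (hF : ∀ x, 1 ≤ ‖x‖ → F x = 0) {s : ℝ} (hs : 0 < s) {c x : E n}
    (hx : x ∉ Metric.closedBall c s⁻¹) : rescale F s c x = 0 := by
  refine hF _ ?_
  rw [Metric.mem_closedBall, not_le, dist_eq_norm, inv_lt_iff_one_lt_mul₀ hs] at hx
  rw [norm_smul, Real.norm_of_nonneg hs.le, mul_comm]
  exact hx.le

lemma hasCompactSupport_rescale {F : E n → ℂ} (hF : ∀ x, 1 ≤ ‖x‖ → F x = 0) {s : ℝ} (hs : 0 < s)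
    (c : E n) : HasCompactSupport (rescale F s c) :=
  HasCompactSupport.intro (isCompact_closedBall c s⁻¹) fun _ hx => rescale_eq_zero hF hs hx

/-- The symbol at frequency `R`, with cutoff `φ` and profile `B`. -/
noncomputable def cutoffBlock (m ρ R : ℝ) (B : E n → ℂ) (φ : E n → ℝ) : E n → ℂ :=
  blockSymbol m ρ R B fun ξ => (φ ((2 * Real.pi)⁻¹ • ξ) : ℂ)

lemma contDiff_cutoff {φ : E n → ℝ} (hφ : ContDiff ℝ ∞ φ) :
    ContDiff ℝ ∞ fun ξ : E n => (φ ((2 * Real.pi)⁻¹ • ξ) : ℂ) :=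
  Complex.ofRealCLM.contDiff.comp (hφ.comp (contDiff_const_smul _))

lemma hasCompactSupport_cutoff {φ : E n → ℝ} (hφ : HasCompactSupport φ) :
    HasCompactSupport fun ξ : E n => (φ ((2 * Real.pi)⁻¹ • ξ) : ℂ) :=
  (hφ.comp_smul (c := (2 * Real.pi)⁻¹) (by positivity)).comp_left (g := ((↑) : ℝ → ℂ))
    Complex.ofReal_zero

lemma hasCompactSupport_cutoffBlock {m ρ R : ℝ} (hR : 0 < R) (B : E n → ℂ) {φ : E n → ℝ}
    (hφ : HasCompactSupport φ) : HasCompactSupport (cutoffBlock m ρ R B φ) := by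
  have h := (hasCompactSupport_cutoff hφ).comp_smul (c := R⁻¹) (by positivity)
  have h2 : HasCompactSupport fun ξ : E n => B (R ^ (-ρ) • ξ) *
      (φ ((2 * Real.pi)⁻¹ • (R⁻¹ • ξ)) : ℂ) := h.mul_left
  exact h2.smul_left (f := fun _ => R ^ m)

lemma cutoffBlock_two_pi {m ρ R : ℝ} (B : E n → ℂ) (φ : E n → ℝ) (η : E n) :
    cutoffBlock m ρ R B φ ((2 * Real.pi) • η) =
      (R ^ m : ℝ) * (B ((2 * Real.pi) • R ^ (-ρ) • η) * φ (R⁻¹ • η)) := by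
  rw [cutoffBlock, blockSymbol, Complex.real_smul, smul_comm R⁻¹, smul_comm (R ^ (-ρ)),
    inv_smul_smul₀ (by positivity)]

lemma fourier_rescale (F : E n → ℂ) (c : E n) {s : ℝ} (hs : 0 < s) (η : E n) :
    𝓕 (rescale F s c) η =
      ((s ^ n)⁻¹ : ℝ) * (Real.fourierChar (-inner ℝ c η) * 𝓕 F (s⁻¹ • η)) := by
  rw [← Complex.real_smul]
  exact fourier_comp_smul_sub F c hs η

lemma fourierChar_mul_conj (t : ℝ) :
    (Real.fourierChar t : ℂ) * starRingEnd ℂ (Real.fourierChar t : ℂ) = 1 := by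
  rw [Complex.mul_conj, Circle.normSq_coe, Complex.ofReal_one]

/-- Testing a plane wave block on two bumps displaced along the wave. -/
lemma norm_pairing_planeWave {a : E n → E n → ℂ} {m ρ R : ℝ} (hR : 0 < R) {φ : E n → ℝ}
    (hφ : ContDiff ℝ ∞ φ) (hφc : HasCompactSupport φ) {e c : E n}
    (ha : ∀ x, rescale bump R (c - R ^ (-ρ) • e) x ≠ 0 → ∀ ξ,
      a x ξ = cutoffBlock m ρ R (planeWave e) φ ξ) :
    ‖pairing (pseudo a (rescale bump R c)) (rescale bump R (c - R ^ (-ρ) • e))‖ =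
      R ^ m * (R ^ n)⁻¹ * |∫ η, φ η * ‖𝓕 (bump (n := n)) η‖ ^ 2| := by
  have hz : ∀ x : E n, 1 ≤ ‖x‖ → bump x = 0 := fun x hx => bump_eq_zero hx
  have hi : ∀ c : E n, Integrable (rescale bump R c) := fun c =>
    (contDiff_rescale contDiff_bump R c).continuous.integrable_of_hasCompactSupport
      (hasCompactSupport_rescale hz hR c)
  have hb : Continuous (cutoffBlock m ρ R (planeWave e) φ) :=
    (contDiff_blockSymbol (contDiff_planeWave e) (contDiff_cutoff hφ)).continuous
  rw [pairing_pseudo_eq hb (hasCompactSupport_cutoffBlock hR _ hφc) (hi _) (hi _) ha]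
  set H : E n → ℂ := fun η => ((φ η * ‖𝓕 (bump (n := n)) η‖ ^ 2 : ℝ) : ℂ) with hH
  have h : ∀ η : E n, cutoffBlock m ρ R (planeWave e) φ ((2 * Real.pi) • η) *
      𝓕 (rescale bump R c) η * starRingEnd ℂ (𝓕 (rescale bump R (c - R ^ (-ρ) • e)) η) =
      ((R ^ m * (R ^ n)⁻¹ * (R ^ n)⁻¹ : ℝ) : ℂ) * H (R⁻¹ • η) := by
    intro η
    rw [cutoffBlock_two_pi, fourier_rescale _ _ hR, fourier_rescale _ _ hR]
    -- The multiplier is translation by `-R^{-ρ} e`, precisely the displacement of the second bump,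
    -- so all phases cancel and a positive integral remains.
    have e1 : planeWave e ((2 * Real.pi) • R ^ (-ρ) • η) =
        (Real.fourierChar (inner ℝ (R ^ (-ρ) • e) η) : ℂ) := by
      rw [planeWave, Real.fourierChar_apply, real_inner_smul_right, real_inner_smul_right,
        real_inner_smul_left]
    have e2 : (Real.fourierChar (-inner ℝ (c - R ^ (-ρ) • e) η) : ℂ) =
        Real.fourierChar (-inner ℝ c η) * Real.fourierChar (inner ℝ (R ^ (-ρ) • e) η) := by
      rw [inner_sub_left, neg_sub, sub_eq_neg_add, AddChar.map_add_eq_mul, Circle.coe_mul]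
    have e3 := fourierChar_mul_conj (-inner ℝ c η)
    have e4 := fourierChar_mul_conj (inner ℝ (R ^ (-ρ) • e) η)
    rw [e1, e2, hH]
    simp only [map_mul, Complex.conj_ofReal]
    rw [← Complex.normSq_eq_norm_sq]
    push_cast
    rw [← Complex.mul_conj]
    linear_combination ((R ^ m : ℝ) : ℂ) * ((R : ℂ) ^ n)⁻¹ * ((R : ℂ) ^ n)⁻¹ * φ (R⁻¹ • η) *
      𝓕 bump (R⁻¹ • η) * starRingEnd ℂ (𝓕 bump (R⁻¹ • η)) *
      ((Real.fourierChar (inner ℝ (R ^ (-ρ) • e) η) : ℂ) *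
        starRingEnd ℂ (Real.fourierChar (inner ℝ (R ^ (-ρ) • e) η) : ℂ) * e3 + e4)
  simp_rw [h]
  rw [integral_const_mul, integral_comp_inv_smul_eq H hR,
    show ∫ x, H x = ((∫ η, φ η * ‖𝓕 (bump (n := n)) η‖ ^ 2 : ℝ) : ℂ) from integral_ofReal, norm_mul, norm_smul,
    Complex.norm_real, Complex.norm_real, Real.norm_of_nonneg (by positivity),
    Real.norm_of_nonneg (by positivity), Real.norm_eq_abs]
  field_simp

/-- The multiplier testing integral of a chirp block. -/
noncomputable def chirpIntegral (φ : E n → ℝ) (Λ N : ℝ) : ℂ :=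
  ∫ ζ : E n, (φ (N⁻¹ • ζ) : ℂ) * 𝓕 (bump (n := n)) (N⁻¹ • ζ) *
        ((‖𝓕 (chirpBump (n := n) Λ) ζ‖ ^ 2 : ℝ) : ℂ)

lemma integral_chirp_scaled {m ρ R Λ : ℝ} (hR : 0 < R) (H : E n → ℂ) :
    ∫ η : E n, ((R ^ m * (R ^ n)⁻¹ * ((R ^ ρ) ^ n)⁻¹ * Λ ^ ((n : ℝ) / 2) : ℝ) : ℂ) *
      H ((R ^ ρ)⁻¹ • η) =
    ((R ^ m * (R ^ n)⁻¹ * Λ ^ ((n : ℝ) / 2) : ℝ) : ℂ) * ∫ ζ, H ζ := by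
  have hRρ : 0 < R ^ ρ := by positivity
  rw [integral_const_mul, integral_comp_inv_smul_eq H hRρ, Complex.real_smul, ← mul_assoc,
    ← Complex.ofReal_mul]
  congr 2
  field_simp

/-- Testing a chirp block on a concentrated bump and a chirp. -/
lemma norm_pairing_chirp {a : E n → E n → ℂ} {m ρ R Λ : ℝ} (hR : 0 < R) (hΛ : 0 < Λ) {φ : E n → ℝ}
    (hφ : ContDiff ℝ ∞ φ) (hφc : HasCompactSupport φ) {c : E n}
    (ha : ∀ x, rescale (chirpBump Λ) (R ^ ρ) c x ≠ 0 → ∀ ξ,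
      a x ξ = cutoffBlock m ρ R (chirpProfile Λ) φ ξ) :
    ‖pairing (pseudo a (rescale bump R c)) (rescale (chirpBump Λ) (R ^ ρ) c)‖ =
      R ^ m * (R ^ n)⁻¹ * Λ ^ ((n : ℝ) / 2) * ‖chirpIntegral φ Λ (R ^ (1 - ρ))‖ := by
  have hRρ : 0 < R ^ ρ := by positivity
  have hz : ∀ x : E n, 1 ≤ ‖x‖ → bump x = 0 := fun x hx => bump_eq_zero hx
  have hz' : ∀ x : E n, 1 ≤ ‖x‖ → chirpBump Λ x = 0 := fun x hx => by
    rw [chirpBump, bump_eq_zero hx, mul_zero]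
  have hi : Integrable (rescale bump R c) :=
    (contDiff_rescale contDiff_bump R c).continuous.integrable_of_hasCompactSupport
      (hasCompactSupport_rescale hz hR c)
  have hi' : Integrable (rescale (chirpBump Λ) (R ^ ρ) c) :=
    (contDiff_rescale (contDiff_chirpBump Λ) _ c).continuous.integrable_of_hasCompactSupport
      (hasCompactSupport_rescale hz' hRρ c)
  have hb : Continuous (cutoffBlock m ρ R (chirpProfile Λ) φ) :=
    (contDiff_blockSymbol (contDiff_chirpProfile Λ) (contDiff_cutoff hφ)).continuous
  rw [pairing_pseudo_eq hb (hasCompactSupport_cutoffBlock hR _ hφc) hi hi' ha]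
  -- At the natural scale `ζ = R^{-ρ} η` of the chirp, the multiplier and the test chirp combine
  -- into `|𝓕 chirp|²`, while the bump and cutoff live at scale `R^{1-ρ}`.
  set H : E n → ℂ := fun ζ => (φ ((R ^ (1 - ρ))⁻¹ • ζ) : ℂ) *
    𝓕 (bump (n := n)) ((R ^ (1 - ρ))⁻¹ • ζ) *
        ((‖𝓕 (chirpBump (n := n) Λ) ζ‖ ^ 2 : ℝ) : ℂ) with hH
  have hRinv : ∀ η : E n, (R ^ (1 - ρ))⁻¹ • (R ^ ρ)⁻¹ • η = R⁻¹ • η := by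
    intro η
    rw [smul_smul, ← mul_inv, ← Real.rpow_add hR, sub_add_cancel, Real.rpow_one]
  have h : ∀ η : E n, cutoffBlock m ρ R (chirpProfile Λ) φ ((2 * Real.pi) • η) *
      𝓕 (rescale bump R c) η * starRingEnd ℂ (𝓕 (rescale (chirpBump Λ) (R ^ ρ) c) η) =
      ((R ^ m * (R ^ n)⁻¹ * ((R ^ ρ) ^ n)⁻¹ * Λ ^ ((n : ℝ) / 2) : ℝ) : ℂ) *
        H ((R ^ ρ)⁻¹ • η) := by
    intro η
    rw [cutoffBlock_two_pi, fourier_rescale _ _ hR, fourier_rescale _ _ hRρ, hH]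
    simp only [hRinv, chirpProfile_two_pi]
    rw [Real.rpow_neg hR.le]
    have e3 := fourierChar_mul_conj (-inner ℝ c η)
    simp only [map_mul, Complex.conj_ofReal]
    rw [← Complex.normSq_eq_norm_sq]
    push_cast
    rw [← Complex.mul_conj]
    linear_combination ((R ^ m : ℝ) : ℂ) * ((R : ℂ) ^ n)⁻¹ * (((R ^ ρ : ℝ) : ℂ) ^ n)⁻¹ *
      ((Λ ^ ((n : ℝ) / 2) : ℝ) : ℂ) * φ (R⁻¹ • η) *
      𝓕 bump (R⁻¹ • η) * 𝓕 (chirpBump Λ) ((R ^ ρ)⁻¹ • η) *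
      starRingEnd ℂ (𝓕 (chirpBump Λ) ((R ^ ρ)⁻¹ • η)) * e3
  simp_rw [h]
  rw [integral_chirp_scaled hR, norm_mul, Complex.norm_real,
    Real.norm_of_nonneg (by positivity)]
  rfl

/-- Evenness of the chirped bump removes the reflection that conjugation normally causes on the
Fourier side. -/
lemma fourier_conj_chirpBump (Λ : ℝ) (η : E n) :
    𝓕 (fun x => starRingEnd ℂ (chirpBump Λ x)) η = starRingEnd ℂ (𝓕 (chirpBump (n := n) Λ) η) := by
  have h1 := fourier_conj (chirpBump (n := n) Λ) (-η)
  rw [neg_neg, ← fourier_comp_neg] at h1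
  simp_rw [chirpBump_neg] at h1
  exact h1

/-- Testing a chirp block on the conjugate chirp and a concentrated bump. -/
lemma norm_pairing_chirp' {a : E n → E n → ℂ} {m ρ R Λ : ℝ} (hR : 0 < R) (hΛ : 0 < Λ) {φ : E n → ℝ}
    (hφ : ContDiff ℝ ∞ φ) (hφc : HasCompactSupport φ) {c : E n}
    (ha : ∀ x, rescale bump R c x ≠ 0 → ∀ ξ,
      a x ξ = cutoffBlock m ρ R (chirpProfile Λ) φ ξ) :
    ‖pairing (pseudo a (rescale (fun x => starRingEnd ℂ (chirpBump Λ x)) (R ^ ρ) c))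
      (rescale bump R c)‖ =
      R ^ m * (R ^ n)⁻¹ * Λ ^ ((n : ℝ) / 2) * ‖chirpIntegral φ Λ (R ^ (1 - ρ))‖ := by
  have hRρ : 0 < R ^ ρ := by positivity
  have hz : ∀ x : E n, 1 ≤ ‖x‖ → bump x = 0 := fun x hx => bump_eq_zero hx
  have hz' : ∀ x : E n, 1 ≤ ‖x‖ → starRingEnd ℂ (chirpBump Λ x) = 0 := fun x hx => by
    rw [chirpBump, bump_eq_zero hx, mul_zero, map_zero]
  have hi : Integrable (rescale bump R c) :=
    (contDiff_rescale contDiff_bump R c).continuous.integrable_of_hasCompactSupport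
      (hasCompactSupport_rescale hz hR c)
  have hi' : Integrable (rescale (fun x => starRingEnd ℂ (chirpBump Λ x)) (R ^ ρ) c) :=
    (contDiff_rescale (Complex.conjCLE.contDiff.comp (contDiff_chirpBump Λ)) _ c).continuous
      |>.integrable_of_hasCompactSupport (hasCompactSupport_rescale hz' hRρ c)
  have hb : Continuous (cutoffBlock m ρ R (chirpProfile Λ) φ) :=
    (contDiff_blockSymbol (contDiff_chirpProfile Λ) (contDiff_cutoff hφ)).continuous
  rw [pairing_pseudo_eq hb (hasCompactSupport_cutoffBlock hR _ hφc) hi' hi ha]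
  -- With the roles exchanged, the integrand is the complex conjugate of the one for a concentrated
  -- input, so the two pairings have the same modulus.
  set H : E n → ℂ := fun ζ => starRingEnd ℂ ((φ ((R ^ (1 - ρ))⁻¹ • ζ) : ℂ) *
    𝓕 (bump (n := n)) ((R ^ (1 - ρ))⁻¹ • ζ) *
        ((‖𝓕 (chirpBump (n := n) Λ) ζ‖ ^ 2 : ℝ) : ℂ)) with hH
  have hRinv : ∀ η : E n, (R ^ (1 - ρ))⁻¹ • (R ^ ρ)⁻¹ • η = R⁻¹ • η := by
    intro η
    rw [smul_smul, ← mul_inv, ← Real.rpow_add hR, sub_add_cancel, Real.rpow_one]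
  have h : ∀ η : E n, cutoffBlock m ρ R (chirpProfile Λ) φ ((2 * Real.pi) • η) *
      𝓕 (rescale (fun x => starRingEnd ℂ (chirpBump Λ x)) (R ^ ρ) c) η *
        starRingEnd ℂ (𝓕 (rescale bump R c) η) =
      ((R ^ m * (R ^ n)⁻¹ * ((R ^ ρ) ^ n)⁻¹ * Λ ^ ((n : ℝ) / 2) : ℝ) : ℂ) *
        H ((R ^ ρ)⁻¹ • η) := by
    intro η
    rw [cutoffBlock_two_pi, fourier_rescale _ _ hR, fourier_rescale _ _ hRρ, hH,
      fourier_conj_chirpBump]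
    simp only [hRinv, chirpProfile_two_pi]
    rw [Real.rpow_neg hR.le]
    have e3 := fourierChar_mul_conj (-inner ℝ c η)
    simp only [map_mul, Complex.conj_ofReal]
    rw [← Complex.normSq_eq_norm_sq]
    push_cast
    rw [← Complex.mul_conj]
    linear_combination ((R ^ m : ℝ) : ℂ) * ((R : ℂ) ^ n)⁻¹ * (((R ^ ρ : ℝ) : ℂ) ^ n)⁻¹ *
      ((Λ ^ ((n : ℝ) / 2) : ℝ) : ℂ) * φ (R⁻¹ • η) *
      starRingEnd ℂ (𝓕 bump (R⁻¹ • η)) * 𝓕 (chirpBump Λ) ((R ^ ρ)⁻¹ • η) *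
      starRingEnd ℂ (𝓕 (chirpBump Λ) ((R ^ ρ)⁻¹ • η)) * e3
  simp_rw [h]
  rw [integral_chirp_scaled hR, norm_mul, Complex.norm_real,
    Real.norm_of_nonneg (by positivity), hH, integral_conj, RCLike.norm_conj]
  rfl

/-! ### Failure of sparse bounds along each family -/

open Filter

lemma norm_le_of_enorm_le {z : ℂ} {C η K Y : ℝ} (hη : 0 < η) (hY : 0 ≤ Y) {Λ : ℝ≥0∞}
    (h1 : ‖z‖ₑ ≤ ENNReal.ofReal C * Λ)
    (h2 : Λ ≤ (ENNReal.ofReal η)⁻¹ * ENNReal.ofReal (K * Y)) :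
    ‖z‖ ≤ |C| * η⁻¹ * |K| * Y := by
  rw [← ENNReal.ofReal_le_ofReal_iff (by positivity), ofReal_norm]
  calc ‖z‖ₑ ≤ ENNReal.ofReal C * ((ENNReal.ofReal η)⁻¹ * ENNReal.ofReal (K * Y)) := by
        refine h1.trans ?_
        gcongr
    _ ≤ ENNReal.ofReal |C| * (ENNReal.ofReal η⁻¹ * ENNReal.ofReal (|K| * Y)) := by
        rw [ENNReal.ofReal_inv_of_pos hη]
        gcongr
        · exact le_abs_self C
        · exact le_abs_self K
    _ = _ := by
        rw [← ENNReal.ofReal_mul (by positivity), ← ENNReal.ofReal_mul (by positivity)]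
        congr 1
        ring

lemma not_forall_rpow_le {R : ℕ → ℝ} (hR : Tendsto R atTop atTop) {θ k₁ k₂ : ℝ} (hθ : 0 < θ)
    (hk : 0 < k₁) (h : ∀ᶠ j in atTop, R j ^ θ * k₁ ≤ k₂) : False := by
  have h1 : Tendsto (fun j => R j ^ θ * k₁) atTop atTop :=
    ((tendsto_rpow_atTop hθ).comp hR).atTop_mul_const hk
  obtain ⟨j, hj, hj'⟩ := (h.and (h1.eventually_gt_atTop k₂)).exists
  exact absurd hj (not_le.2 hj')

lemma norm_rescale_le_one {F : E n → ℂ} (hF : ∀ x, ‖F x‖ ≤ 1) (s : ℝ) (c x : E n) :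
    ‖rescale F s c x‖ ≤ 1 := hF _

lemma norm_sub_le_of_rescale_ne_zero {F : E n → ℂ} (hF : ∀ x, 1 ≤ ‖x‖ → F x = 0) {s : ℝ}
    (hs : 1 ≤ s) {c x : E n} (hx : rescale F s c x ≠ 0) : ‖x - c‖ ≤ 1 := by
  have h : x ∈ Metric.closedBall c s⁻¹ := by
    by_contra h
    exact hx (rescale_eq_zero hF (by linarith) h)
  rw [Metric.mem_closedBall, dist_eq_norm] at h
  exact h.trans (inv_le_one_of_one_le₀ hs)

/-- Plane wave blocks violate sparse bounds beyond the line `u + w = 1 - m / (n (1 - ρ))`. -/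
lemma not_hasSparseBound_of_planeWave (hn : 0 < n) {a : E n → E n → ℂ} {m ρ : ℝ} (hρ0 : 0 ≤ ρ)
    {φ : E n → ℝ} (hφ : ContDiff ℝ ∞ φ) (hφc : HasCompactSupport φ)
    (hφ0 : 0 < ∫ η, φ η * ‖𝓕 (bump (n := n)) η‖ ^ 2) {e : E n} (he : ‖e‖ = 1)
    {c : ℕ → E n} {R : ℕ → ℝ} (hR1 : ∀ j, 1 ≤ R j) (hR : Tendsto R atTop atTop)
    (ha : ∀ j x, ‖x - c j‖ ≤ 2 → ∀ ξ, a x ξ = cutoffBlock m ρ (R j) (planeWave e) φ ξ)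
    {p q u w : ℝ} (hp : 1 ≤ p) (hq : 1 ≤ q)
    (hu0 : 0 ≤ u) (hu : u ≤ 1 / p) (hu1 : u < 1) (hw0 : 0 ≤ w) (hw : w ≤ 1 / q) (hw1 : w < 1)
    (huw : 1 < u + w) (hθ : 0 < m - n * (1 - ρ) + n * (1 - ρ) * (u + w)) :
    ¬ HasSparseBound a p q := by
  rintro ⟨η, hη, -, C, hC⟩
  obtain ⟨K, hK⟩ := exists_sparseForm_separated_le hn hp hq hu0 hu hu1 hw0 hw hw1 huw
  have hz : ∀ x : E n, 1 ≤ ‖x‖ → bump x = 0 := fun x hx => bump_eq_zero hx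
  refine not_forall_rpow_le hR hθ hφ0 (k₂ := |C| * η⁻¹ * |K|) (Eventually.of_forall fun j => ?_)
  have hRj : 0 < R j := by linarith [hR1 j]
  set d : ℝ := R j ^ (-ρ) with hd
  have hd0 : 0 < d := by positivity
  have hd1 : d ≤ 1 := Real.rpow_le_one_of_one_le_of_nonpos (hR1 j) (by linarith)
  have hde : ‖d • e‖ = d := by rw [norm_smul, he, mul_one, Real.norm_of_nonneg hd0.le]
  obtain ⟨S, hS, hb⟩ := hC _ _ (contDiff_rescale contDiff_bump (R j) (c j))
    (hasCompactSupport_rescale hz hRj _) (contDiff_rescale contDiff_bump (R j) (c j - d • e))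
    (hasCompactSupport_rescale hz hRj _)
  have h := norm_le_of_enorm_le hη (by positivity) hb (hK η S _ _ (c j) (c j - d • e) (R j)⁻¹ d hη hS
    (by positivity) hd0 (by rw [sub_sub_cancel, hde])
    (norm_rescale_le_one norm_bump_le_one _ _) (norm_rescale_le_one norm_bump_le_one _ _)
    (fun x hx => rescale_eq_zero hz hRj hx) (fun x hx => rescale_eq_zero hz hRj hx))
  rw [norm_pairing_planeWave hRj hφ hφc, abs_of_pos hφ0] at h
  -- The quotient of the pairing by the sparse majorant is `R^θ` up to constants, with `θ` the
  -- exponent assumed positive.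
  · have e1 : R j ^ m * (R j ^ n)⁻¹ = R j ^ (m - n * (1 - ρ) + n * (1 - ρ) * (u + w)) *
        (d ^ n * (((R j)⁻¹ / d) ^ ((n : ℝ) * u) * ((R j)⁻¹ / d) ^ ((n : ℝ) * w))) := by
      have e2 : (R j)⁻¹ / d = R j ^ (ρ - 1) := by
        rw [hd, ← Real.rpow_neg_one, ← Real.rpow_sub hRj]; ring_nf
      rw [e2, hd, ← Real.rpow_natCast, ← Real.rpow_natCast, ← Real.rpow_neg hRj.le,
        ← Real.rpow_mul hRj.le, ← Real.rpow_mul hRj.le, ← Real.rpow_mul hRj.le,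
        ← Real.rpow_add hRj, ← Real.rpow_add hRj, ← Real.rpow_add hRj, ← Real.rpow_add hRj]
      congr 1
      ring
    rw [e1] at h
    refine le_of_mul_le_mul_right ?_ (by positivity :
      0 < d ^ n * (((R j)⁻¹ / d) ^ ((n : ℝ) * u) * ((R j)⁻¹ / d) ^ ((n : ℝ) * w)))
    linarith
  · intro x hx
    refine ha j x ?_
    have h1 := norm_sub_le_of_rescale_ne_zero hz (hR1 j) hx
    calc ‖x - c j‖ = ‖(x - (c j - d • e)) - d • e‖ := by congr 1; abel
      _ ≤ ‖x - (c j - d • e)‖ + ‖d • e‖ := norm_sub_le _ _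
      _ ≤ 2 := by rw [hde]; linarith

/-- Chirp blocks violate sparse bounds beyond the lines `u = 1 / 2 - m / (n (1 - ρ))` and
`w = 1 / 2 - m / (n (1 - ρ))`. -/
lemma not_hasSparseBound_of_chirp (hn : 0 < n) {a : E n → E n → ℂ} {m ρ : ℝ} (hρ0 : 0 ≤ ρ)
    (hρ1 : ρ < 1) {φ : E n → ℝ} (hφ : ContDiff ℝ ∞ φ) (hφc : HasCompactSupport φ)
    {ε c' N₀ : ℝ} (hε : 0 < ε) (hc' : 0 < c')
    (hφ0 : ∀ N : ℝ, N₀ ≤ N → 1 ≤ N → c' ≤ ‖chirpIntegral φ (ε * N) N‖)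
    {c : ℕ → E n} {R : ℕ → ℝ} (hR1 : ∀ j, 1 ≤ R j) (hR : Tendsto R atTop atTop)
    (ha : ∀ j x, ‖x - c j‖ ≤ 2 → ∀ ξ,
      a x ξ = cutoffBlock m ρ (R j) (chirpProfile (ε * R j ^ (1 - ρ))) φ ξ)
    {p q u w : ℝ} (hp : 1 ≤ p) (hq : 1 ≤ q)
    (hu0 : 0 ≤ u) (hu1 : u < 1) (hw0 : 0 ≤ w)
    (huw : 1 < u + w) (hθ : 0 < m - n * (1 - ρ) / 2 + n * (1 - ρ) * u)
    (h : (u ≤ 1 / p ∧ w ≤ 1 / q) ∨ (u ≤ 1 / q ∧ w ≤ 1 / p)) :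
    ¬ HasSparseBound a p q := by
  rintro ⟨η, hη, -, C, hC⟩
  have hz : ∀ x : E n, 1 ≤ ‖x‖ → bump x = 0 := fun x hx => bump_eq_zero hx
  have hN : Tendsto (fun j => R j ^ (1 - ρ)) atTop atTop :=
    (tendsto_rpow_atTop (by linarith)).comp hR
  obtain ⟨K, hK⟩ : ∃ K : ℝ, ∀ᶠ j in atTop, R j ^ m * (R j ^ n)⁻¹ *
      (ε * R j ^ (1 - ρ)) ^ ((n : ℝ) / 2) * c' ≤ K *
      (((R j ^ ρ)⁻¹) ^ n * ((R j)⁻¹ / (R j ^ ρ)⁻¹) ^ ((n : ℝ) * u)) := by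
    -- In both cases `u` is the exponent attached to the concentrated bump: it is the first test
    -- function here, and the second one, paired with the conjugate chirp, in the other case.
    rcases h with ⟨hu, hw⟩ | ⟨hu, hw⟩
    · obtain ⟨K, hK⟩ := exists_sparseForm_concentric_le hn hp hq hu0 hu hu1 hw0 hw huw
      refine ⟨|C| * η⁻¹ * |K|, ?_⟩
      filter_upwards [hN.eventually_ge_atTop N₀] with j hj
      have hRj : 0 < R j := by linarith [hR1 j]
      have hN1 : 1 ≤ R j ^ (1 - ρ) := Real.one_le_rpow (hR1 j) (by linarith)
      have hRρ : 1 ≤ R j ^ ρ := Real.one_le_rpow (hR1 j) hρ0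
      have hRρ0 : 0 < R j ^ ρ := by linarith
      set Λ := ε * R j ^ (1 - ρ) with hΛ
      have hΛ0 : 0 < Λ := by positivity
      have hz' : ∀ x : E n, 1 ≤ ‖x‖ → chirpBump Λ x = 0 := fun x hx => by
        rw [chirpBump, bump_eq_zero hx, mul_zero]
      have hb' : ∀ x : E n, ‖chirpBump Λ x‖ ≤ 1 := fun x => by
        rw [norm_chirpBump]; exact norm_bump_le_one x
      obtain ⟨S, hS, hb⟩ := hC _ _ (contDiff_rescale contDiff_bump (R j) (c j))
        (hasCompactSupport_rescale hz hRj _)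
        (contDiff_rescale (contDiff_chirpBump Λ) (R j ^ ρ) (c j))
        (hasCompactSupport_rescale hz' hRρ0 _)
      have h := norm_le_of_enorm_le hη (by positivity) hb (hK η S _ _ (c j) (R j)⁻¹ (R j ^ ρ)⁻¹ hη hS
        (by positivity) (by positivity)
        (norm_rescale_le_one norm_bump_le_one _ _) (norm_rescale_le_one hb' _ _)
        (fun x hx => rescale_eq_zero hz hRj hx) (fun x hx => rescale_eq_zero hz' hRρ0 hx))
      rw [norm_pairing_chirp hRj hΛ0 hφ hφc fun x hx => ha j x
        ((norm_sub_le_of_rescale_ne_zero hz' hRρ hx).trans one_le_two)] at h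
      refine le_trans ?_ h
      gcongr
      exact hφ0 _ hj hN1
    · obtain ⟨K, hK⟩ := exists_sparseForm_concentric_le hn hq hp hu0 hu hu1 hw0 hw huw
      refine ⟨|C| * η⁻¹ * |K|, ?_⟩
      filter_upwards [hN.eventually_ge_atTop N₀] with j hj
      have hRj : 0 < R j := by linarith [hR1 j]
      have hN1 : 1 ≤ R j ^ (1 - ρ) := Real.one_le_rpow (hR1 j) (by linarith)
      have hRρ : 1 ≤ R j ^ ρ := Real.one_le_rpow (hR1 j) hρ0
      have hRρ0 : 0 < R j ^ ρ := by linarith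
      set Λ := ε * R j ^ (1 - ρ) with hΛ
      have hΛ0 : 0 < Λ := by positivity
      have hz' : ∀ x : E n, 1 ≤ ‖x‖ → starRingEnd ℂ (chirpBump Λ x) = 0 := fun x hx => by
        rw [chirpBump, bump_eq_zero hx, mul_zero, map_zero]
      have hb' : ∀ x : E n, ‖starRingEnd ℂ (chirpBump Λ x)‖ ≤ 1 := fun x => by
        rw [RCLike.norm_conj, norm_chirpBump]; exact norm_bump_le_one x
      obtain ⟨S, hS, hb⟩ := hC _ _
        (contDiff_rescale (Complex.conjCLE.contDiff.comp (contDiff_chirpBump Λ)) (R j ^ ρ) (c j))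
        (hasCompactSupport_rescale hz' hRρ0 _)
        (contDiff_rescale contDiff_bump (R j) (c j))
        (hasCompactSupport_rescale hz hRj _)
      rw [sparseForm_comm] at hb
      have h := norm_le_of_enorm_le hη (by positivity) hb (hK η S _ _ (c j) (R j)⁻¹ (R j ^ ρ)⁻¹ hη hS
        (by positivity) (by positivity)
        (norm_rescale_le_one norm_bump_le_one _ _) (norm_rescale_le_one hb' _ _)
        (fun x hx => rescale_eq_zero hz hRj hx) (fun x hx => rescale_eq_zero hz' hRρ0 hx))
      have h' := norm_pairing_chirp' hRj hΛ0 hφ hφc (a := a) (m := m) (c := c j) fun x hx => ha j x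
        ((norm_sub_le_of_rescale_ne_zero hz (hR1 j) hx).trans one_le_two)
      refine le_trans ?_ (h'.symm.le.trans h)
      gcongr
      exact hφ0 _ hj hN1
  -- The term `n(1 - ρ)/2` is the gain from `Λ^{n/2}`, separated from the volume factors.
  have hθ' : 0 < m - n * (1 - ρ) + n * (1 - ρ) / 2 + n * (1 - ρ) * u := by linarith
  refine not_forall_rpow_le hR hθ' (k₁ := ε ^ ((n : ℝ) / 2) * c') (k₂ := K) (by positivity) ?_
  filter_upwards [hK] with j hj
  have hRj : 0 < R j := by linarith [hR1 j]
  have e1 : R j ^ m * (R j ^ n)⁻¹ * (ε * R j ^ (1 - ρ)) ^ ((n : ℝ) / 2) * c' =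
      R j ^ (m - n * (1 - ρ) + n * (1 - ρ) / 2 + n * (1 - ρ) * u) * (ε ^ ((n : ℝ) / 2) * c') *
      (((R j ^ ρ)⁻¹) ^ n * ((R j)⁻¹ / (R j ^ ρ)⁻¹) ^ ((n : ℝ) * u)) := by
    have e2 : (R j)⁻¹ / (R j ^ ρ)⁻¹ = R j ^ (ρ - 1) := by
      rw [← Real.rpow_neg hRj.le, ← Real.rpow_neg_one, ← Real.rpow_sub hRj]; ring_nf
    have e3 : R j ^ m * (R j ^ n)⁻¹ * (R j ^ (1 - ρ)) ^ ((n : ℝ) / 2) =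
        R j ^ (m - n * (1 - ρ) + n * (1 - ρ) / 2 + n * (1 - ρ) * u) *
        (((R j ^ ρ)⁻¹) ^ n * (R j ^ (ρ - 1)) ^ ((n : ℝ) * u)) := by
      rw [← Real.rpow_natCast, ← Real.rpow_natCast, ← Real.rpow_neg hRj.le,
        ← Real.rpow_neg hRj.le, ← Real.rpow_mul hRj.le, ← Real.rpow_mul hRj.le,
        ← Real.rpow_mul hRj.le, ← Real.rpow_add hRj, ← Real.rpow_add hRj, ← Real.rpow_add hRj,
        ← Real.rpow_add hRj]
      congr 1
      ring
    rw [e2, Real.mul_rpow hε.le (by positivity)]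
    linear_combination (ε ^ ((n : ℝ) / 2) * c') * e3
  rw [e1] at hj
  exact le_of_mul_le_mul_right hj (by positivity)

/-! ### Assembling the symbol -/

/-- The profiles of the blocks: plane waves at even indices and chirps at odd ones. -/
noncomputable def alternatingProfile (e : E n) (Λ : ℕ → ℝ) (j : ℕ) : E n → ℂ :=
  if Even j then planeWave e else chirpProfile (Λ j)

lemma contDiff_alternatingProfile (e : E n) (Λ : ℕ → ℝ) (j : ℕ) :
    ContDiff ℝ ∞ (alternatingProfile e Λ j) := by
  unfold alternatingProfile
  split_ifs
  · exact contDiff_planeWave e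
  · exact contDiff_chirpProfile _

lemma exists_norm_iteratedFDeriv_alternatingProfile_le (e : E n) {Λ : ℕ → ℝ} (hΛ : ∀ j, 0 < Λ j)
    (k : ℕ) : ∃ C : ℝ, ∀ j η, ‖iteratedFDeriv ℝ k (alternatingProfile e Λ j) η‖ ≤ C := by
  obtain ⟨C, hC⟩ := exists_norm_iteratedFDeriv_chirpProfile_le n k
  refine ⟨max (‖e‖ ^ k) C, fun j η => ?_⟩
  unfold alternatingProfile
  split_ifs
  · exact (norm_iteratedFDeriv_planeWave_le e k η).trans (le_max_left _ _)
  · exact (hC _ (hΛ j) η).trans (le_max_right _ _)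

/-- There is a symbol all of whose sparse bounds lie in the closed trapezoid. -/
theorem exists_isSymbol_not_hasSparseBound (n : ℕ) (hn : 0 < n) (m ρ δ : ℝ) (hδ : 0 ≤ δ) (hδρ : δ ≤ ρ) (hρ : ρ < 1)
    (hm : -((n : ℝ) * (1 - ρ)) ≤ m) (hm0 : m < 0) :
    ∃ a : E n → E n → ℂ,
      IsSymbol m ρ δ a ∧
      (∀ r s' : ℝ, 1 ≤ r → 1 ≤ s' → 1 < 1 / r + 1 / s' →
        (1 / r, 1 / s') ∉ closure (trapezoid n m ρ) →
        ¬ HasSparseBound a r s') ∧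
      (-((n : ℝ) * (1 - ρ)) / 2 < m →
        ∀ r s' : ℝ, 1 ≤ r → 1 ≤ s' → 1 < 1 / r + 1 / s' →
          1 / 2 - m / ((n : ℝ) * (1 - ρ)) < 1 / r →
          ¬ HasSparseBound a r s') := by
  have hρ0 : 0 ≤ ρ := hδ.trans hδρ
  have hn' : (0 : ℝ) < n := by exact_mod_cast hn
  have hν : 0 < (n : ℝ) * (1 - ρ) := mul_pos hn' (by linarith)
  obtain ⟨φ, hφ, hφc, ⟨c, r, hc, hr, hφr⟩, hφ0⟩ := exists_frequency_cutoff n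
  obtain ⟨ε, c', N₀, hε, hc', hchirp⟩ := exists_le_norm_integral_chirpBump hn hφ hφc hc hr hφr
  set e : E n := EuclideanSpace.single ⟨0, hn⟩ 1
  have he : ‖e‖ = 1 := by simp [e]
  set R : ℕ → ℝ := fun j => 2 ^ j with hRdef
  have hR1 : ∀ j, 1 ≤ R j := fun j => one_le_pow₀ one_le_two
  have hR : Tendsto R atTop atTop := tendsto_pow_atTop_atTop_of_one_lt one_lt_two
  set Λ : ℕ → ℝ := fun j => ε * R j ^ (1 - ρ) with hΛdef
  have hΛ : ∀ j, 0 < Λ j := fun j => by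
    have : 0 < R j := by linarith [hR1 j]
    positivity
  set b : ℕ → E n → ℂ := fun j => cutoffBlock m ρ (R j) (alternatingProfile e Λ j) φ with hb
  set a := gluedSymbol e b with ha
  have heven : Tendsto (fun j : ℕ => 2 * j) atTop atTop :=
    tendsto_atTop_mono (fun j => Nat.le_mul_of_pos_left j two_pos) tendsto_id
  have hodd : Tendsto (fun j : ℕ => 2 * j + 1) atTop atTop := 
    tendsto_atTop_mono (fun j => Nat.le_succ _) heven
  have hwave : ∀ p q u w : ℝ, 1 ≤ p → 1 ≤ q → 0 ≤ u → u ≤ 1 / p → u < 1 → 0 ≤ w → w ≤ 1 / q →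
      w < 1 → 1 < u + w → 0 < m - n * (1 - ρ) + n * (1 - ρ) * (u + w) → ¬ HasSparseBound a p q :=
    fun p q u w hp hq hu0 hu hu1 hw0 hw hw1 huw hθ =>
      not_hasSparseBound_of_planeWave hn hρ0 hφ hφc hφ0 he
        (c := fun j => (10 * (2 * j : ℕ) : ℝ) • e)
        (R := fun j => R (2 * j)) (fun j => hR1 _) (hR.comp heven)
        (fun j x hx ξ => by
          rw [ha, gluedSymbol_eq_of_norm_le he hx, hb]
          simp [alternatingProfile])
        hp hq hu0 hu hu1 hw0 hw hw1 huw hθ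
  have hchirps : ∀ p q u w : ℝ, 1 ≤ p → 1 ≤ q → 0 ≤ u → u < 1 → 0 ≤ w → 1 < u + w →
      0 < m - n * (1 - ρ) / 2 + n * (1 - ρ) * u →
      (u ≤ 1 / p ∧ w ≤ 1 / q) ∨ (u ≤ 1 / q ∧ w ≤ 1 / p) → ¬ HasSparseBound a p q :=
    fun p q u w hp hq hu0 hu1 hw0 huw hθ h =>
      not_hasSparseBound_of_chirp hn hρ0 hρ hφ hφc hε hc' hchirp
        (c := fun j => (10 * (2 * j + 1 : ℕ) : ℝ) • e)
        (R := fun j => R (2 * j + 1)) (fun j => hR1 _) (hR.comp hodd)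
        (fun j x hx ξ => by
          rw [ha, gluedSymbol_eq_of_norm_le he hx, hb]
          simp [alternatingProfile, hΛdef])
        hp hq hu0 hu1 hw0 huw hθ h
  set μ : ℝ := -m / (n * (1 - ρ)) with hμ
  have hμ0 : 0 < μ := div_pos (by linarith) hν
  have hmμ : m = -(n * (1 - ρ) * μ) := by
    have := div_mul_cancel₀ (-m) hν.ne'
    rw [← hμ] at this
    linarith
  have hone : ∀ x : ℝ, 1 ≤ x → 0 < 1 / x ∧ 1 / x ≤ 1 := fun x hx =>
    ⟨by positivity, (div_le_one (by linarith)).2 hx⟩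
  have hside : ∀ p q u w : ℝ, 1 ≤ p → 1 ≤ q → 0 < w → w ≤ 1 → u ≤ 1 → 1 < u + w → 1 / 2 + μ < u →
      (u ≤ 1 / p ∧ w ≤ 1 / q) ∨ (u ≤ 1 / q ∧ w ≤ 1 / p) → ¬ HasSparseBound a p q := by
    intro p q u w hp hq hw0 hw1 hu1 huw hu h
    -- The exponent is lowered strictly below `u ≤ 1`, as integrability at the center needs, while
    -- staying above `1/2 + μ` and keeping `v + w > 1`.
    obtain ⟨v, hv1, hv2⟩ := exists_between (max_lt hu (by linarith : 1 - w < u))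
    rw [max_lt_iff] at hv1
    refine hchirps p q v w hp hq (by linarith) (by linarith) hw0.le (by linarith) ?_ ?_
    · rw [hmμ]
      nlinarith [mul_pos hν (by linarith : 0 < v - 1 / 2 - μ)]
    · rcases h with ⟨h1, h2⟩ | ⟨h1, h2⟩
      · exact Or.inl ⟨hv2.le.trans h1, h2⟩
      · exact Or.inr ⟨hv2.le.trans h1, h2⟩
  refine ⟨a, ?_, ?_, ?_⟩
  · refine isSymbol_gluedSymbol he hδ (fun j => ?_) fun k => ?_
    · exact contDiff_blockSymbol (contDiff_alternatingProfile e Λ j) (contDiff_cutoff hφ)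
    · exact exists_norm_iteratedFDeriv_blockSymbol_le hm0.le hρ0 hρ.le hR1
        (contDiff_alternatingProfile e Λ)
        (exists_norm_iteratedFDeriv_alternatingProfile_le e hΛ) (contDiff_cutoff hφ)
        (hasCompactSupport_cutoff hφc) k
  · intro p q hp hq hpq hout
    obtain ⟨hp0, hp1⟩ := hone p hp
    obtain ⟨hq0, hq1⟩ := hone q hq
    rcases exponents_of_notMem_closure_trapezoid hn hρ hm hm0 hp1 hq1 hpq hout with h | h | h
    · rw [← hμ] at h
      -- Removing a third of the excess over `1 + μ` from each exponent makes both strictly less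
      -- than 1 and leaves a third of the excess.
      refine hwave p q (1 / p - (1 / p + 1 / q - 1 - μ) / 3) (1 / q - (1 / p + 1 / q - 1 - μ) / 3)
        hp hq ?_ ?_ ?_ ?_ ?_ ?_ ?_ ?_ <;> try linarith
      rw [hmμ]
      nlinarith [mul_pos hν (by linarith : 0 < 1 / p + 1 / q - 1 - μ)]
    · exact hside p q (1 / p) (1 / q) hp hq hq0 hq1 hp1 hpq h (Or.inl ⟨le_rfl, le_rfl⟩)
    · exact hside p q (1 / q) (1 / p) hp hq hp0 hp1 hq1 (by linarith) h (Or.inr ⟨le_rfl, le_rfl⟩)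
  · intro _ p q hp hq hpq h
    obtain ⟨hp0, hp1⟩ := hone p hp
    obtain ⟨hq0, hq1⟩ := hone q hq
    refine hside p q (1 / p) (1 / q) hp hq hq0 hq1 hp1 hpq ?_ (Or.inl ⟨le_rfl, le_rfl⟩)
    rw [hμ, neg_div]
    linarith

end PseudoSparse

theorem mainTheorem5 (n : ℕ) (hn : 0 < n) (m ρ δ : ℝ) (hδ : 0 ≤ δ) (hδρ : δ ≤ ρ) (hρ : ρ < 1)
    (hm : -((n : ℝ) * (1 - ρ)) ≤ m) (hm0 : m < 0) :
    ∃ a : PseudoSparse.E n → PseudoSparse.E n → ℂ,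
      PseudoSparse.IsSymbol m ρ δ a ∧
      (∀ r s' : ℝ, 1 ≤ r → 1 ≤ s' → 1 < 1 / r + 1 / s' →
        (1 / r, 1 / s') ∉ closure (PseudoSparse.trapezoid n m ρ) →
        ¬ PseudoSparse.HasSparseBound a r s') ∧
      (-((n : ℝ) * (1 - ρ)) / 2 < m →
        ∀ r s' : ℝ, 1 ≤ r → 1 ≤ s' → 1 < 1 / r + 1 / s' →
          1 / 2 - m / ((n : ℝ) * (1 - ρ)) < 1 / r →
          ¬ PseudoSparse.HasSparseBound a r s') :=
  PseudoSparse.exists_isSymbol_not_hasSparseBound n hn m ρ δ hδ hδρ hρ hm hm0
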